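/- For $w\in\mathbb{C}$ let $$J_0(w)=\sum_{n=0}^\infty \frac{(-w^2/4)^n}{(n!)^2},\qquad Y_0(w)=\frac{2}{\pi}\log\Big(\frac w2\Big)J_0(w)-\frac{2}{\pi}\sum_{n=0}^\infty\psi(n+1)\frac{(-w^2/4)^n}{(n!)^2}\quad(w\neq0)$$ be the Bessel and Neumann functions of order $0$ ($\psi$ is the digamma function). For $x>0$ and $z\in\mathbb{C}$ set $$\phi_{-\frac12}(z,x)=\sqrt{\frac{\pi x}{2}}\,J_0(\sqrt z\,x),\qquad \theta_{-\frac12}(z,x)=\sqrt{\frac{\pi x}{2}}\Big(\frac1\pi\log(z)J_0(\sqrt z\,x)-Y_0(\sqrt z\,x)\Big),$$ with principal branches of $\log$ and of the square root (cut along the negative real axis, $\arg\in(-\pi,\pi]$); at $z=0$ the value of $\theta_{-\frac12}(\cdot,x)$ is its limit $-\sqrt{2x/\pi}\,(\log(x/2)+\gamma)$, with $\gamma$ the Euler–Mascheroni constant. Let $$G_{-\frac12}(z,x,y)=\phi_{-\frac12}(z,x)\,\theta_{-\frac12}(z,y)-\phi_{-\frac12}(z,y)\,\theta_{-\frac12}(z,x).$$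 Then there is an absolute constant $C>0$ such that for all $k\in\mathbb{C}$ the following holds. For all $x>0$, the function $k\mapsto\phi_{-\frac12}(k^2,x)$ is complex differentiable at $k$ and $$|\partial_k\phi_{-\frac12}(k^2,x)|\le C\,|k|x\left(\frac{x}{1+|k|x}\right)^{\frac32}e^{|\mathrm{Im}\,k|\,x}.$$ For all $0<y\le x<\infty$, the function $k\mapsto G_{-\frac12}(k^2,x,y)$ is complex differentiable at $k$ and $$|\partial_kG_{-\frac12}(k^2,x,y)|\le C\,|k|x\left(\frac{x}{1+|k|x}\right)^{\frac32}\left(\frac{y}{1+|k|y}\right)^{\frac12}\left(1+\log\frac xy\right)e^{|\mathrm{Im}\,k|(x-y)}.$$ -/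

import Mathlib

/-- The Bessel function of the first kind of order zero,
`J₀(w) = ∑ₙ (-w²/4)ⁿ / (n!)²`. -/
noncomputable def besselJZero (w : ℂ) : ℂ :=
  ∑' n : ℕ, (-(w ^ 2) / 4) ^ n / ((n.factorial : ℂ) ^ 2)

/-- The Neumann function (Bessel function of the second kind) of order zero, with the principal
branch of the logarithm:
`Y₀(w) = (2/π) log(w/2) J₀(w) - (2/π) ∑ₙ ψ(n+1) (-w²/4)ⁿ / (n!)²`,
where `ψ` is the digamma function. -/
noncomputable def besselYZero (w : ℂ) : ℂ :=
  2 / (Real.pi : ℂ) * Complex.log (w / 2) * besselJZero w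
    - 2 / (Real.pi : ℂ) *
      ∑' n : ℕ, Complex.digamma ((n : ℂ) + 1) * (-(w ^ 2) / 4) ^ n / ((n.factorial : ℂ) ^ 2)

/-- The free regular solution `φ_{-1/2}(z,x) = √(πx/2) J₀(√z x)`, principal square root. -/
noncomputable def freePhi (z : ℂ) (x : ℝ) : ℂ :=
  (Real.sqrt (Real.pi * x / 2) : ℂ) * besselJZero (z ^ (1 / 2 : ℂ) * (x : ℂ))

/-- The free singular solution
`θ_{-1/2}(z,x) = √(πx/2) ((1/π) log(z) J₀(√z x) - Y₀(√z x))`, principal branches.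
The logarithms of `z` cancel, so that this is entire in `z` after filling in the removable
singularity at `z = 0`, where the value is the limit `-√(2x/π) (log(x/2) + γ)`. -/
noncomputable def freeTheta (z : ℂ) (x : ℝ) : ℂ :=
  open Classical in
  if z = 0 then
    ((-(Real.sqrt (2 * x / Real.pi) *
      (Real.log (x / 2) + Real.eulerMascheroniConstant)) : ℝ) : ℂ)
  else
    (Real.sqrt (Real.pi * x / 2) : ℂ) *
      (1 / (Real.pi : ℂ) * Complex.log z * besselJZero (z ^ (1 / 2 : ℂ) * (x : ℂ))
        - besselYZero (z ^ (1 / 2 : ℂ) * (x : ℂ)))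

/-- The free Green's function
`G_{-1/2}(z,x,y) = φ_{-1/2}(z,x) θ_{-1/2}(z,y) - φ_{-1/2}(z,y) θ_{-1/2}(z,x)`. -/
noncomputable def freeGreen (z : ℂ) (x y : ℝ) : ℂ :=
  freePhi z x * freeTheta z y - freePhi z y * freeTheta z x

/-! The function $x\mapsto G(k^2,x,y)$ solves $u''=-(k^2+\frac1{4x^2})u$ with $u(y)=0$, $u'(y)=1$.
Riemann's method suggests the formula $G(k^2,x,y)=(x-y)\int_0^1\cos(k(x-y)s)\,F(m(s))\,ds$, with
$F(m)=P_{-1/2}(1+2m)$ and $m(s)=(x-y)^2(1-s^2)/(4xy)$. It is verified by showing that the integral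
solves the same Cauchy problem (`hasDerivAt_greenRepDeriv`, `freeGreen_eq_greenRep`). The factor
$e^{|\mathrm{Im}\,k|(x-y)}$ is then visible, since only frequencies up to $x-y$ occur.

The $k$-derivative is $-(x-y)^2\int_0^1 sF(m(s))\sin(k(x-y)s)\,ds$. Its amplitude $sF(m(s))$ is
nonnegative and nondecreasing, equals $1$ at $s=1$, and is at most a constant times $(1+\log\frac
xy)\sqrt{y/x}\,(1-s)^{-1/2}$ (`riemannFun_greenArg_le`). With $\kappa=k(x-y)$ this gives three
bounds for the integral: linear in $|\kappa|$ by absolute values, $|\kappa|^{-1/2}$ by cutting at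
distance $1/|\kappa|$ from the endpoint, and $|\kappa|^{-1}$ by integration by parts. They serve the
regimes $|k|x\le1$, $|k|y\le1<|k|x$ and $|k|y>1$ respectively (`norm_greenRep_param_deriv_le`).

The bound for $\phi$ needs no separate oscillatory estimate: up to a constant factor,
$\partial_k\phi(k^2,x)$ is the limit as $y\to0$ of $\partial_kG(k^2,x,y)/(\sqrt y\,(1+\log\frac
xy))$ (`tendsto_deriv_freeGreen`). -/

open Set Filter Topology MeasureTheory Interval

/-! ### Parameter integrals and elliptic moments. -/

/-- Differentiation under an interval integral with jointly continuous derivative. -/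
theorem hasDerivAt_intervalIntegral_of_continuousOn {𝕜 E : Type*} [RCLike 𝕜]
    [NormedAddCommGroup E] [NormedSpace ℝ E] [NormedSpace 𝕜 E]
    {U : Set 𝕜} (hU : IsOpen U) {a b : ℝ} (hab : a ≤ b) {f f' : 𝕜 → ℝ → E}
    (hf : ∀ x ∈ U, ContinuousOn (f x) (Icc a b))
    (hf' : ContinuousOn (Function.uncurry f') (U ×ˢ Icc a b))
    (hd : ∀ x ∈ U, ∀ t ∈ Icc a b, HasDerivAt (fun x => f x t) (f' x t) x)
    {x₀ : 𝕜} (hx₀ : x₀ ∈ U) :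
    HasDerivAt (fun x => ∫ t in a..b, f x t) (∫ t in a..b, f' x₀ t) x₀ := by
  obtain ⟨r, hr, hrU⟩ := Metric.nhds_basis_closedBall.mem_iff.1 (hU.mem_nhds hx₀)
  have hK : IsCompact (Metric.closedBall x₀ r ×ˢ Icc a b) :=
    (isCompact_closedBall x₀ r).prod isCompact_Icc
  obtain ⟨M, hM⟩ := hK.exists_bound_of_continuousOn (hf'.mono (prod_mono hrU le_rfl))
  have hsub : Ι a b ⊆ Icc a b := by
    rw [uIoc_of_le hab]; exact Ioc_subset_Icc_self
  have hmeas : ∀ g : ℝ → E, ContinuousOn g (Icc a b) →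
      AEStronglyMeasurable g (volume.restrict (Ι a b)) := fun g hg =>
    (hg.aestronglyMeasurable measurableSet_Icc).mono_measure (Measure.restrict_mono hsub le_rfl)
  refine (intervalIntegral.hasDerivAt_integral_of_dominated_loc_of_deriv_le
    (bound := fun _ => M) (Metric.closedBall_mem_nhds x₀ hr) ?_ ?_ ?_ ?_ ?_ ?_).2
  · filter_upwards [hU.mem_nhds hx₀] with x hx
    exact hmeas _ (hf x hx)
  · exact (hf x₀ hx₀).intervalIntegrable_of_Icc hab
  · refine hmeas _ (hf'.comp (f := fun t => (x₀, t)) (by fun_prop) fun t ht => ⟨hx₀, ht⟩)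
  · exact ae_of_all _ fun t ht x hx => hM (x, t) ⟨hx, hsub ht⟩
  · exact intervalIntegrable_const
  · exact ae_of_all _ fun t ht x hx => hd x (hrU hx) t (hsub ht)

/-- The elliptic-type integrals `∫₀^{π/2} sin^{2q} u (1 + m sin² u)^{-q-1/2} du`. -/
noncomputable def ellipticMoment (q : ℕ) (m : ℝ) : ℝ :=
  ∫ u in (0 : ℝ)..(Real.pi / 2),
    Real.sin u ^ (2 * q) * (1 + m * Real.sin u ^ 2) ^ (-((q : ℝ) + 1 / 2))

lemma one_add_mul_sin_sq_pos {m : ℝ} (hm : -1 < m) (u : ℝ) : 0 < 1 + m * Real.sin u ^ 2 := by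
  have h1 := Real.sin_sq_le_one u
  rcases (sq_nonneg (Real.sin u)).eq_or_lt with h0 | h0
  · simp [← h0]
  · nlinarith

/-- The exponents are tied to `q` so that differentiation in $m$ stays in the family. The range
$m>-1$ makes $m=0$ an interior point, which is needed because the argument vanishes at $s=1$. -/
lemma hasDerivAt_ellipticMoment (q : ℕ) {m : ℝ} (hm : -1 < m) :
    HasDerivAt (ellipticMoment q) (-((q : ℝ) + 1 / 2) * ellipticMoment (q + 1) m) m := by
  have key := hasDerivAt_intervalIntegral_of_continuousOn (𝕜 := ℝ) (E := ℝ) (U := Ioi (-1))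
    isOpen_Ioi (a := 0) (b := Real.pi / 2) (by positivity)
    (f := fun m u => Real.sin u ^ (2 * q) * (1 + m * Real.sin u ^ 2) ^ (-((q : ℝ) + 1 / 2)))
    (f' := fun m u => -((q : ℝ) + 1 / 2) * (Real.sin u ^ (2 * (q + 1)) *
      (1 + m * Real.sin u ^ 2) ^ (-(((q + 1 : ℕ) : ℝ) + 1 / 2)))) ?_ ?_ ?_ (x₀ := m) hm
  · rw [intervalIntegral.integral_const_mul] at key
    exact key
  · intro m hm
    refine ContinuousOn.mul (by fun_prop) (ContinuousOn.rpow_const (by fun_prop) ?_)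
    exact fun u _ => Or.inl (one_add_mul_sin_sq_pos hm u).ne'
  · refine ContinuousOn.mul (by fun_prop) (ContinuousOn.mul (by fun_prop)
      (ContinuousOn.rpow_const (by fun_prop) ?_))
    exact fun p hp => Or.inl (one_add_mul_sin_sq_pos hp.1 p.2).ne'
  · intro m hm u _
    have hpos := one_add_mul_sin_sq_pos hm u
    have h1 : HasDerivAt (fun m : ℝ => 1 + m * Real.sin u ^ 2) (Real.sin u ^ 2) m := by
      simpa using ((hasDerivAt_id m).mul_const (Real.sin u ^ 2)).const_add 1
    have h2 := (h1.rpow_const (p := -((q : ℝ) + 1 / 2)) (Or.inl hpos.ne')).const_mul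
      (Real.sin u ^ (2 * q))
    refine h2.congr_deriv ?_
    have : -((q : ℝ) + 1 / 2) - 1 = -(((q + 1 : ℕ) : ℝ) + 1 / 2) := by push_cast; ring
    rw [this]; ring

lemma intervalIntegrable_ellipticMoment (q : ℕ) {m : ℝ} (hm : -1 < m) :
    IntervalIntegrable (fun u => Real.sin u ^ (2 * q) *
      (1 + m * Real.sin u ^ 2) ^ (-((q : ℝ) + 1 / 2))) volume 0 (Real.pi / 2) := by
  apply Continuous.intervalIntegrable
  refine Continuous.mul (by fun_prop) (Continuous.rpow_const (by fun_prop) ?_)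
  exact fun u => Or.inl (one_add_mul_sin_sq_pos hm u).ne'

lemma ellipticMoment_nonneg (q : ℕ) {m : ℝ} (hm : -1 < m) : 0 ≤ ellipticMoment q m :=
  intervalIntegral.integral_nonneg (by positivity) fun u _ =>
    mul_nonneg (by rw [pow_mul]; positivity)
      (Real.rpow_nonneg (one_add_mul_sin_sq_pos hm u).le _)

/-- The hypergeometric differential equation satisfied by `ellipticMoment 0`. -/
lemma ellipticMoment_ode {m : ℝ} (hm : -1 < m) :
    3 / 4 * (m * (1 + m)) * ellipticMoment 2 m - 1 / 2 * (1 + 2 * m) * ellipticMoment 1 m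
      + 1 / 4 * ellipticMoment 0 m = 0 := by
  have i0 := intervalIntegrable_ellipticMoment 0 hm
  have i1 := intervalIntegrable_ellipticMoment 1 hm
  have i2 := intervalIntegrable_ellipticMoment 2 hm
  unfold ellipticMoment
  rw [← intervalIntegral.integral_const_mul, ← intervalIntegral.integral_const_mul,
    ← intervalIntegral.integral_const_mul, ← intervalIntegral.integral_sub (i2.const_mul _)
    (i1.const_mul _), ← intervalIntegral.integral_add ((i2.const_mul _).sub (i1.const_mul _))
    (i0.const_mul _)]
  -- The combined integrand is exact; its primitive contains $\sin u\cos u$ and so vanishes at $0$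
  -- and $\pi/2$.
  have hd : ∀ u : ℝ, HasDerivAt (fun u => 1 / 4 * (Real.sin u * Real.cos u) *
      (1 + m * Real.sin u ^ 2) ^ (-(3 / 2) : ℝ))
      (3 / 4 * (m * (1 + m)) * (Real.sin u ^ (2 * 2) *
        (1 + m * Real.sin u ^ 2) ^ (-(((2 : ℕ) : ℝ) + 1 / 2)))
      - 1 / 2 * (1 + 2 * m) * (Real.sin u ^ (2 * 1) *
        (1 + m * Real.sin u ^ 2) ^ (-(((1 : ℕ) : ℝ) + 1 / 2)))
      + 1 / 4 * (Real.sin u ^ (2 * 0) *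
        (1 + m * Real.sin u ^ 2) ^ (-(((0 : ℕ) : ℝ) + 1 / 2)))) u := by
    intro u
    have hpos := one_add_mul_sin_sq_pos hm u
    have hs := Real.hasDerivAt_sin u
    have hc := Real.hasDerivAt_cos u
    have h1 := ((hs.pow 2).const_mul m).const_add 1
    have h2 := h1.rpow_const (p := (-(3 / 2) : ℝ)) (Or.inl hpos.ne')
    have h3 := ((hs.mul hc).const_mul (1 / 4)).mul h2
    refine h3.congr_deriv ?_
    have e1 : (-(3 / 2) - 1 : ℝ) = -(5 / 2) := by norm_num
    have e2 : (-(((2 : ℕ) : ℝ) + 1 / 2)) = -(5 / 2) := by norm_num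
    have e3 : (-(((1 : ℕ) : ℝ) + 1 / 2)) = -(3 / 2) := by norm_num
    have e4 : (-(((0 : ℕ) : ℝ) + 1 / 2)) = -(1 / 2) := by norm_num
    have e5 : (1 + m * Real.sin u ^ 2) ^ (-(3 / 2) : ℝ) =
        (1 + m * Real.sin u ^ 2) ^ (-(5 / 2) : ℝ) * (1 + m * Real.sin u ^ 2) := by
      rw [← Real.rpow_add_one hpos.ne']; norm_num
    have e6 : (1 + m * Real.sin u ^ 2) ^ (-(1 / 2) : ℝ) =
        (1 + m * Real.sin u ^ 2) ^ (-(5 / 2) : ℝ) * (1 + m * Real.sin u ^ 2) ^ 2 := by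
      rw [← Real.rpow_natCast (1 + m * Real.sin u ^ 2) 2, ← Real.rpow_add hpos]; norm_num
    simp only [e1, e2, e3, e4, Pi.mul_apply, Pi.pow_apply]
    rw [e5, e6]
    generalize (1 + m * Real.sin u ^ 2) ^ (-(5 / 2) : ℝ) = D
    have hcs : Real.cos u ^ 2 = 1 - Real.sin u ^ 2 := by
      linarith [Real.sin_sq_add_cos_sq u]
    push_cast
    linear_combination (D * (1 / 4 * (1 + m * Real.sin u ^ 2) -
      3 / 4 * m * Real.sin u ^ 2)) * hcs
  rw [intervalIntegral.integral_eq_sub_of_hasDerivAt (fun u _ => hd u)]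
  · simp
  · exact ((i2.const_mul _).sub (i1.const_mul _)).add (i0.const_mul _)

lemma ellipticMoment_zero_zero : ellipticMoment 0 0 = Real.pi / 2 := by
  simp [ellipticMoment]

lemma ellipticMoment_zero_anti {m n : ℝ} (hm : -1 < m) (hmn : m ≤ n) :
    ellipticMoment 0 n ≤ ellipticMoment 0 m := by
  refine intervalIntegral.integral_mono_on (by positivity)
    (intervalIntegrable_ellipticMoment 0 (hm.trans_le hmn))
    (intervalIntegrable_ellipticMoment 0 hm) fun u _ => ?_
  refine mul_le_mul_of_nonneg_left ?_ (by simp)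
  exact Real.rpow_le_rpow_of_nonpos (one_add_mul_sin_sq_pos hm u) (by gcongr) (by norm_num)

/-- Jordan's inequality $\sin u\ge 2u/\pi$ and $(1+t)^2\le2(1+t^2)$ bound the integrand by a
multiple of $1/(1+ct)$-type functions of $u$, whose integral is a logarithm. This is the origin of
the factor $1+\log\frac xy$. -/
lemma ellipticMoment_zero_le {m : ℝ} (hm : 0 < m) :
    ellipticMoment 0 m ≤ Real.pi / 2 * (Real.sqrt 2 * Real.log (1 + Real.sqrt m) / Real.sqrt m) := by
  have hs : 0 < Real.sqrt m := Real.sqrt_pos.2 hm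
  have hsq := Real.sq_sqrt hm.le
  have hπ := Real.pi_pos
  have hpos : ∀ u ∈ Icc (0 : ℝ) (Real.pi / 2), 0 < 1 + 2 / Real.pi * Real.sqrt m * u := by
    intro u hu; have := hu.1; positivity
  have hu : uIcc (0 : ℝ) (Real.pi / 2) = Icc 0 (Real.pi / 2) := uIcc_of_le (by positivity)
  have hd : ∀ u ∈ uIcc (0 : ℝ) (Real.pi / 2), HasDerivAt
      (fun u => Real.pi / 2 * (Real.sqrt 2 / Real.sqrt m) *
        Real.log (1 + 2 / Real.pi * Real.sqrt m * u))
      (Real.sqrt 2 * (1 + 2 / Real.pi * Real.sqrt m * u)⁻¹) u := by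
    intro u huu
    rw [hu] at huu
    have h1 : HasDerivAt (fun u : ℝ => 1 + 2 / Real.pi * Real.sqrt m * u)
        (2 / Real.pi * Real.sqrt m) u := by
      simpa using ((hasDerivAt_id u).const_mul (2 / Real.pi * Real.sqrt m)).const_add 1
    refine ((h1.log (hpos u huu).ne').const_mul _).congr_deriv ?_
    have := (hpos u huu).ne'
    field_simp
  have hi : IntervalIntegrable (fun u => Real.sqrt 2 * (1 + 2 / Real.pi * Real.sqrt m * u)⁻¹)
      volume 0 (Real.pi / 2) := by
    apply ContinuousOn.intervalIntegrable
    rw [hu]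
    exact ContinuousOn.mul (by fun_prop) (ContinuousOn.inv₀ (by fun_prop)
      fun u huu => (hpos u huu).ne')
  have hF := intervalIntegral.integral_eq_sub_of_hasDerivAt hd hi
  have : ellipticMoment 0 m ≤ ∫ u in (0 : ℝ)..(Real.pi / 2),
      Real.sqrt 2 * (1 + 2 / Real.pi * Real.sqrt m * u)⁻¹ := by
    refine intervalIntegral.integral_mono_on (by positivity)
      (intervalIntegrable_ellipticMoment 0 (by linarith)) hi fun u huu => ?_
    have hp := hpos u huu
    have hjordan : 2 / Real.pi * u ≤ Real.sin u := Real.mul_le_sin huu.1 huu.2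
    have hD := one_add_mul_sin_sq_pos (m := m) (by linarith) u
    have h0 : 0 ≤ 2 / Real.pi * u := by have := huu.1; positivity
    have key : (1 + 2 / Real.pi * Real.sqrt m * u) / Real.sqrt 2 ≤
        Real.sqrt (1 + m * Real.sin u ^ 2) := by
      apply Real.le_sqrt_of_sq_le
      rw [div_pow, Real.sq_sqrt (by norm_num)]
      have h2 : (2 / Real.pi * u) ^ 2 ≤ Real.sin u ^ 2 := by gcongr
      have h3 : m * (2 / Real.pi * u) ^ 2 ≤ m * Real.sin u ^ 2 := by gcongr
      have h4 : (2 / Real.pi * Real.sqrt m * u) ^ 2 = m * (2 / Real.pi * u) ^ 2 := by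
        rw [← hsq]; simp only [Real.sqrt_sq hs.le]; ring
      nlinarith [sq_nonneg (1 - 2 / Real.pi * Real.sqrt m * u)]
    simp only [mul_zero, pow_zero, one_mul, Nat.cast_zero, zero_add]
    rw [Real.rpow_neg hD.le, ← Real.sqrt_eq_rpow]
    have h5 := inv_anti₀ (by positivity) key
    rwa [inv_div, div_eq_mul_inv] at h5
  refine this.trans (le_of_eq ?_)
  rw [hF]
  have : 2 / Real.pi * Real.sqrt m * (Real.pi / 2) = Real.sqrt m := by field_simp
  rw [this]
  simp
  ring

/-! ### The Riemann function. -/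

/-- The Legendre function `P_{-1/2}(1 + 2m)`, the Riemann function of the free operator. -/
noncomputable def riemannFun (m : ℝ) : ℝ := 2 / Real.pi * ellipticMoment 0 m

/-- The derivative of `riemannFun`. -/
noncomputable def riemannFunDeriv (m : ℝ) : ℝ := -(1 / Real.pi) * ellipticMoment 1 m

/-- The second derivative of `riemannFun`. -/
noncomputable def riemannFunDerivTwo (m : ℝ) : ℝ := 3 / (2 * Real.pi) * ellipticMoment 2 m

lemma hasDerivAt_riemannFun {m : ℝ} (hm : -1 < m) :
    HasDerivAt riemannFun (riemannFunDeriv m) m := by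
  refine ((hasDerivAt_ellipticMoment 0 hm).const_mul _).congr_deriv ?_
  simp only [riemannFunDeriv]; push_cast; ring

lemma hasDerivAt_riemannFunDeriv {m : ℝ} (hm : -1 < m) :
    HasDerivAt riemannFunDeriv (riemannFunDerivTwo m) m := by
  refine ((hasDerivAt_ellipticMoment 1 hm).const_mul _).congr_deriv ?_
  simp only [riemannFunDerivTwo]; push_cast; ring

lemma continuousOn_riemannFun : ContinuousOn riemannFun (Ioi (-1)) :=
  fun _ hm => (hasDerivAt_riemannFun hm).continuousAt.continuousWithinAt

lemma continuousOn_riemannFunDeriv : ContinuousOn riemannFunDeriv (Ioi (-1)) :=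
  fun _ hm => (hasDerivAt_riemannFunDeriv hm).continuousAt.continuousWithinAt

lemma continuousOn_riemannFunDerivTwo : ContinuousOn riemannFunDerivTwo (Ioi (-1)) :=
  fun _ hm => ((hasDerivAt_ellipticMoment 2 hm).const_mul _).continuousAt.continuousWithinAt

lemma riemannFun_ode {m : ℝ} (hm : -1 < m) :
    m * (1 + m) * riemannFunDerivTwo m + (1 + 2 * m) * riemannFunDeriv m
      + 1 / 4 * riemannFun m = 0 := by
  have h := ellipticMoment_ode hm
  simp only [riemannFun, riemannFunDeriv, riemannFunDerivTwo]
  linear_combination (2 / Real.pi) * h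

lemma riemannFun_zero : riemannFun 0 = 1 := by
  rw [riemannFun, ellipticMoment_zero_zero]
  have := Real.pi_pos.ne'
  field_simp

lemma riemannFun_anti {m n : ℝ} (hm : -1 < m) (hmn : m ≤ n) : riemannFun n ≤ riemannFun m :=
  mul_le_mul_of_nonneg_left (ellipticMoment_zero_anti hm hmn) (by positivity)

lemma riemannFun_nonneg {m : ℝ} (hm : -1 < m) : 0 ≤ riemannFun m :=
  mul_nonneg (by positivity) (ellipticMoment_nonneg 0 hm)

lemma riemannFun_le_one {m : ℝ} (hm : 0 ≤ m) : riemannFun m ≤ 1 :=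
  riemannFun_zero ▸ riemannFun_anti (by norm_num) hm

lemma riemannFunDeriv_nonpos {m : ℝ} (hm : -1 < m) : riemannFunDeriv m ≤ 0 := by
  have := ellipticMoment_nonneg 1 hm
  have := Real.pi_pos
  rw [riemannFunDeriv, neg_mul, neg_nonpos]
  positivity

lemma riemannFun_le_log {m : ℝ} (hm : 0 < m) :
    riemannFun m ≤ Real.sqrt 2 * Real.log (1 + Real.sqrt m) / Real.sqrt m := by
  have h := mul_le_mul_of_nonneg_left (ellipticMoment_zero_le hm)
    (show 0 ≤ 2 / Real.pi by positivity)
  refine h.trans (le_of_eq ?_)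
  have := Real.pi_pos.ne'
  field_simp

/-! ### The integral representation and its differential equation. -/

/-- The argument of the Riemann function in the integral representation of the Green's
function. -/
noncomputable def greenArg (x y s : ℝ) : ℝ := (x - y) ^ 2 * (1 - s ^ 2) / (4 * x * y)

lemma greenArg_nonneg {x y s : ℝ} (hx : 0 < x) (hy : 0 < y) (hs : s ∈ Icc (0 : ℝ) 1) :
    0 ≤ greenArg x y s := by
  have : 0 ≤ 1 - s ^ 2 := by nlinarith [hs.1, hs.2]
  unfold greenArg; positivity

lemma neg_one_lt_greenArg {x y s : ℝ} (hx : 0 < x) (hy : 0 < y) (hs : s ∈ Icc (0 : ℝ) 1) :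
    -1 < greenArg x y s := by linarith [greenArg_nonneg hx hy hs]

lemma continuousOn_greenArg {y : ℝ} (hy : 0 < y) :
    ContinuousOn (fun p : ℝ × ℝ => greenArg p.1 y p.2) (Ioi 0 ×ˢ Icc 0 1) := by
  unfold greenArg
  refine ContinuousOn.div (by fun_prop) (by fun_prop) fun p hp => ?_
  have : 0 < p.1 := hp.1
  positivity

lemma continuousOn_comp_greenArg {y : ℝ} (hy : 0 < y) {f : ℝ → ℝ}
    (hf : ContinuousOn f (Ioi (-1))) :
    ContinuousOn (fun p : ℝ × ℝ => ((f (greenArg p.1 y p.2) : ℝ) : ℂ)) (Ioi 0 ×ˢ Icc 0 1) :=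
  Complex.continuous_ofReal.comp_continuousOn
    (hf.comp (continuousOn_greenArg hy) fun _ hp => neg_one_lt_greenArg hp.1 hy hp.2)

lemma continuousOn_comp_greenArg_right {x y : ℝ} (hx : 0 < x) (hy : 0 < y) {f : ℝ → ℝ}
    (hf : ContinuousOn f (Ioi (-1))) :
    ContinuousOn (fun s : ℝ => ((f (greenArg x y s) : ℝ) : ℂ)) (Icc 0 1) :=
  (continuousOn_comp_greenArg hy hf).comp (f := fun s : ℝ => (x, s)) (by fun_prop)
    fun _ hs => ⟨hx, hs⟩

lemma hasDerivAt_greenArg_left {x y : ℝ} (hx : 0 < x) (hy : 0 < y) (s : ℝ) :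
    HasDerivAt (fun x => greenArg x y s) ((1 - s ^ 2) / (4 * y) * (1 - y ^ 2 / x ^ 2)) x := by
  have h1 : HasDerivAt (fun x : ℝ => (x - y) ^ 2 * (1 - s ^ 2))
      (2 * (x - y) * (1 - s ^ 2)) x := by
    simpa using (((hasDerivAt_id x).sub_const y).pow 2).mul_const (1 - s ^ 2)
  have h2 : HasDerivAt (fun x : ℝ => 4 * x * y) (4 * y) x := by
    simpa using ((hasDerivAt_id x).const_mul 4).mul_const y
  refine (h1.div h2 (by positivity)).congr_deriv ?_
  field_simp
  ring

lemma hasDerivAt_greenArg_right {x y : ℝ} (s : ℝ) :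
    HasDerivAt (fun s => greenArg x y s) ((x - y) ^ 2 * (-(2 * s)) / (4 * x * y)) s := by
  have h1 : HasDerivAt (fun s : ℝ => 1 - s ^ 2) (-(2 * s)) s := by
    simpa using ((hasDerivAt_id s).pow 2).const_sub 1
  exact (h1.const_mul _).div_const _

/-- The integrand of `greenRep`. -/
noncomputable def greenKernel (k : ℂ) (y x s : ℝ) : ℂ :=
  ((x - y : ℝ) : ℂ) * Complex.cos (k * (x - y : ℝ) * s) * (riemannFun (greenArg x y s) : ℂ)

/-- The integrand of `greenRepDeriv`. -/
noncomputable def greenKernelDeriv (k : ℂ) (y x s : ℝ) : ℂ :=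
  Complex.cos (k * (x - y : ℝ) * s) * (riemannFun (greenArg x y s) : ℂ)
    - k * (x - y : ℝ) * s * Complex.sin (k * (x - y : ℝ) * s) *
      (riemannFun (greenArg x y s) : ℂ)
    + (x - y : ℝ) * Complex.cos (k * (x - y : ℝ) * s) *
      (riemannFunDeriv (greenArg x y s) : ℂ) *
      (((1 - s ^ 2) / (4 * y) * (1 - y ^ 2 / x ^ 2) : ℝ) : ℂ)

/-- The second derivative of `greenKernel` in its third argument. -/
noncomputable def greenKernelDerivTwo (k : ℂ) (y x s : ℝ) : ℂ :=
  (-(2 * k * s * Complex.sin (k * (x - y : ℝ) * s))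
      - k ^ 2 * (x - y : ℝ) * s ^ 2 * Complex.cos (k * (x - y : ℝ) * s)) *
        (riemannFun (greenArg x y s) : ℂ)
    + (2 * Complex.cos (k * (x - y : ℝ) * s)
      - 2 * k * (x - y : ℝ) * s * Complex.sin (k * (x - y : ℝ) * s)) *
        (riemannFunDeriv (greenArg x y s) : ℂ) *
        (((1 - s ^ 2) / (4 * y) * (1 - y ^ 2 / x ^ 2) : ℝ) : ℂ)
    + (x - y : ℝ) * Complex.cos (k * (x - y : ℝ) * s) *
      ((riemannFunDerivTwo (greenArg x y s) : ℂ) *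
        (((1 - s ^ 2) / (4 * y) * (1 - y ^ 2 / x ^ 2) : ℝ) : ℂ) ^ 2
      + (riemannFunDeriv (greenArg x y s) : ℂ) *
        (((1 - s ^ 2) * y / (2 * x ^ 3) : ℝ) : ℂ))

/-- The integral representation of the free Green's function. -/
noncomputable def greenRep (k : ℂ) (y x : ℝ) : ℂ := ∫ s in (0 : ℝ)..1, greenKernel k y x s

/-- The derivative of `greenRep` with respect to the last variable. -/
noncomputable def greenRepDeriv (k : ℂ) (y x : ℝ) : ℂ :=
  ∫ s in (0 : ℝ)..1, greenKernelDeriv k y x s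

lemma greenRep_self (k : ℂ) (y : ℝ) : greenRep k y y = 0 := by simp [greenRep, greenKernel]

/-- With `greenRep_self`, these are the Cauchy data that identify the integral with the Green's
function. -/
lemma greenRepDeriv_self (k : ℂ) (y : ℝ) : greenRepDeriv k y y = 1 := by
  simp [greenRepDeriv, greenKernelDeriv, greenArg, riemannFun_zero]

lemma hasDerivAt_cos_comp {f : ℝ → ℂ} {f' : ℂ} {x : ℝ} (h : HasDerivAt f f' x) :
    HasDerivAt (fun x => Complex.cos (f x)) (-Complex.sin (f x) * f') x :=
  (Complex.hasDerivAt_cos (f x)).comp x h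

lemma hasDerivAt_sin_comp {f : ℝ → ℂ} {f' : ℂ} {x : ℝ} (h : HasDerivAt f f' x) :
    HasDerivAt (fun x => Complex.sin (f x)) (Complex.cos (f x) * f') x :=
  (Complex.hasDerivAt_sin (f x)).comp x h

lemma hasDerivAt_cos_mul_sub (k : ℂ) (x y s : ℝ) :
    HasDerivAt (fun x : ℝ => Complex.cos (k * (x - y : ℝ) * s))
      (-(k * s * Complex.sin (k * (x - y : ℝ) * s))) x := by
  have h1 : HasDerivAt (fun x : ℝ => k * ((x - y : ℝ) : ℂ) * s) (k * s) x := by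
    simpa using ((((hasDerivAt_id x).sub_const y).ofReal_comp).const_mul k).mul_const (s : ℂ)
  refine (hasDerivAt_cos_comp h1).congr_deriv ?_
  ring

lemma hasDerivAt_sin_mul_sub (k : ℂ) (x y s : ℝ) :
    HasDerivAt (fun x : ℝ => Complex.sin (k * (x - y : ℝ) * s))
      (k * s * Complex.cos (k * (x - y : ℝ) * s)) x := by
  have h1 : HasDerivAt (fun x : ℝ => k * ((x - y : ℝ) : ℂ) * s) (k * s) x := by
    simpa using ((((hasDerivAt_id x).sub_const y).ofReal_comp).const_mul k).mul_const (s : ℂ)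
  refine (hasDerivAt_sin_comp h1).congr_deriv ?_
  ring

lemma hasDerivAt_sub_ofReal (x y : ℝ) : HasDerivAt (fun x : ℝ => ((x - y : ℝ) : ℂ)) 1 x := by
  simpa using ((hasDerivAt_id x).sub_const y).ofReal_comp

lemma ContinuousOn.slice_right {f : ℝ → ℝ → ℂ} {S : Set ℝ} {T : Set ℝ} {x : ℝ} (hx : x ∈ S)
    (hf : ContinuousOn (Function.uncurry f) (S ×ˢ T)) : ContinuousOn (f x) T :=
  hf.comp (f := fun s : ℝ => (x, s)) (by fun_prop) fun _ hs => ⟨hx, hs⟩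

lemma continuousOn_greenArg_deriv {y : ℝ} :
    ContinuousOn (fun p : ℝ × ℝ =>
      (((1 - p.2 ^ 2) / (4 * y) * (1 - y ^ 2 / p.1 ^ 2) : ℝ) : ℂ)) (Ioi 0 ×ˢ Icc 0 1) := by
  refine Complex.continuous_ofReal.comp_continuousOn (ContinuousOn.mul (by fun_prop)
    (continuousOn_const.sub (ContinuousOn.div (by fun_prop) (by fun_prop) fun p hp => ?_)))
  have : 0 < p.1 := hp.1
  positivity

lemma continuousOn_greenArg_deriv_two {y : ℝ} :
    ContinuousOn (fun p : ℝ × ℝ =>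
      (((1 - p.2 ^ 2) * y / (2 * p.1 ^ 3) : ℝ) : ℂ)) (Ioi 0 ×ˢ Icc 0 1) := by
  refine Complex.continuous_ofReal.comp_continuousOn
    (ContinuousOn.div (by fun_prop) (by fun_prop) fun p hp => ?_)
  have : 0 < p.1 := hp.1
  positivity

lemma continuousOn_greenKernel (k : ℂ) {y : ℝ} (hy : 0 < y) :
    ContinuousOn (Function.uncurry (greenKernel k y)) (Ioi 0 ×ˢ Icc 0 1) := by
  have c0 := continuousOn_comp_greenArg hy continuousOn_riemannFun
  unfold greenKernel Function.uncurry
  exact (by fun_prop : ContinuousOn _ _).mul c0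

lemma continuousOn_greenKernelDeriv (k : ℂ) {y : ℝ} (hy : 0 < y) :
    ContinuousOn (Function.uncurry (greenKernelDeriv k y)) (Ioi 0 ×ˢ Icc 0 1) := by
  have c0 := continuousOn_comp_greenArg hy continuousOn_riemannFun
  have c1 := continuousOn_comp_greenArg hy continuousOn_riemannFunDeriv
  unfold greenKernelDeriv Function.uncurry
  exact (((by fun_prop : ContinuousOn _ _).mul c0).sub
    ((by fun_prop : ContinuousOn _ _).mul c0)).add
    (((by fun_prop : ContinuousOn _ _).mul c1).mul continuousOn_greenArg_deriv)

lemma continuousOn_greenKernelDerivTwo (k : ℂ) {y : ℝ} (hy : 0 < y) :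
    ContinuousOn (Function.uncurry (greenKernelDerivTwo k y)) (Ioi 0 ×ˢ Icc 0 1) := by
  have c0 := continuousOn_comp_greenArg hy continuousOn_riemannFun
  have c1 := continuousOn_comp_greenArg hy continuousOn_riemannFunDeriv
  have c2 := continuousOn_comp_greenArg hy continuousOn_riemannFunDerivTwo
  have cm := continuousOn_greenArg_deriv (y := y)
  have cn := continuousOn_greenArg_deriv_two (y := y)
  unfold greenKernelDerivTwo Function.uncurry
  exact (((by fun_prop : ContinuousOn _ _).mul c0).add
    (((by fun_prop : ContinuousOn _ _).mul c1).mul cm)).add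
    ((by fun_prop : ContinuousOn _ _).mul ((c2.mul (cm.pow 2)).add (c1.mul cn)))

lemma hasDerivAt_greenKernel (k : ℂ) {x y s : ℝ} (hx : 0 < x) (hy : 0 < y)
    (hs : s ∈ Icc (0 : ℝ) 1) :
    HasDerivAt (fun x => greenKernel k y x s) (greenKernelDeriv k y x s) x := by
  have hF := ((hasDerivAt_riemannFun (neg_one_lt_greenArg hx hy hs)).comp x
    (hasDerivAt_greenArg_left hx hy s)).ofReal_comp
  refine (((hasDerivAt_sub_ofReal x y).mul (hasDerivAt_cos_mul_sub k x y s)).mul hF).congr_deriv ?_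
  simp only [Function.comp, Pi.mul_apply, greenKernelDeriv]
  push_cast
  ring

lemma hasDerivAt_greenKernelDeriv (k : ℂ) {x y s : ℝ} (hx : 0 < x) (hy : 0 < y)
    (hs : s ∈ Icc (0 : ℝ) 1) :
    HasDerivAt (fun x => greenKernelDeriv k y x s) (greenKernelDerivTwo k y x s) x := by
  have hm := neg_one_lt_greenArg hx hy hs
  have d0 := ((hasDerivAt_riemannFun hm).comp x (hasDerivAt_greenArg_left hx hy s)).ofReal_comp
  have d1 := ((hasDerivAt_riemannFunDeriv hm).comp x
    (hasDerivAt_greenArg_left hx hy s)).ofReal_comp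
  have dL := hasDerivAt_sub_ofReal x y
  have dc := hasDerivAt_cos_mul_sub k x y s
  have ds := hasDerivAt_sin_mul_sub k x y s
  have hx0 : x ≠ 0 := hx.ne'
  have dm : HasDerivAt (fun x : ℝ => (((1 - s ^ 2) / (4 * y) * (1 - y ^ 2 / x ^ 2) : ℝ) : ℂ))
      (((1 - s ^ 2) * y / (2 * x ^ 3) : ℝ) : ℂ) x := by
    have e : HasDerivAt (fun x : ℝ => (1 - s ^ 2) / (4 * y) * (1 - y ^ 2 / x ^ 2))
        ((1 - s ^ 2) * y / (2 * x ^ 3)) x := by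
      have e1 := (((((hasDerivAt_id x).pow 2).fun_inv (by simpa using hx0)).const_mul
        (y ^ 2)).const_sub 1).const_mul ((1 - s ^ 2) / (4 * y))
      refine (e1.congr_deriv ?_).congr_of_eventuallyEq (Eventually.of_forall fun x => ?_)
      · simp only [id, Pi.pow_apply]; push_cast; field_simp; ring
      · simp [div_eq_mul_inv]
    exact e.ofReal_comp
  refine (((dc.mul d0).sub ((((dL.const_mul k).mul_const (s : ℂ)).mul ds).mul d0)).add
    (((dL.mul dc).mul d1).mul dm)).congr_deriv ?_
  simp only [Function.comp, Pi.mul_apply, greenKernelDerivTwo]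
  push_cast
  ring

lemma hasDerivAt_greenRep (k : ℂ) {x y : ℝ} (hx : 0 < x) (hy : 0 < y) :
    HasDerivAt (greenRep k y) (greenRepDeriv k y x) x :=
  hasDerivAt_intervalIntegral_of_continuousOn (f := greenKernel k y)
    (f' := greenKernelDeriv k y) isOpen_Ioi zero_le_one
    (fun _ hx => (continuousOn_greenKernel k hy).slice_right hx)
    (continuousOn_greenKernelDeriv k hy)
    (fun _ hx _ hs => hasDerivAt_greenKernel k hx hy hs) hx

/-- The Bessel operator maps `greenKernel` to a total derivative. -/
lemma hasDerivAt_greenKernel_flux (k : ℂ) {x y s : ℝ} (hx : 0 < x) (hy : 0 < y)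
    (hs : s ∈ Icc (0 : ℝ) 1) :
    HasDerivAt (fun s : ℝ => (1 - (s : ℂ) ^ 2) * (Complex.cos (k * (x - y : ℝ) * s) *
        (riemannFunDeriv (greenArg x y s) : ℂ) * (s * ((x - y : ℝ) / (2 * x ^ 2)))
        + k * Complex.sin (k * (x - y : ℝ) * s) * (riemannFun (greenArg x y s) : ℂ)))
      (greenKernelDerivTwo k y x s + (k ^ 2 + 1 / (4 * (x : ℂ) ^ 2)) * greenKernel k y x s) s := by
  have hm := neg_one_lt_greenArg hx hy hs
  have d0 := ((hasDerivAt_riemannFun hm).comp s (hasDerivAt_greenArg_right s)).ofReal_comp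
  have d1 := ((hasDerivAt_riemannFunDeriv hm).comp s (hasDerivAt_greenArg_right s)).ofReal_comp
  have hid : HasDerivAt (fun s : ℝ => (s : ℂ)) 1 s := (hasDerivAt_id s).ofReal_comp
  have hl : HasDerivAt (fun s : ℝ => k * (x - y : ℝ) * s) (k * (x - y : ℝ)) s := by
    simpa using hid.const_mul (k * ((x - y : ℝ) : ℂ))
  have hode : (((greenArg x y s * (1 + greenArg x y s) * riemannFunDerivTwo (greenArg x y s)
      + (1 + 2 * greenArg x y s) * riemannFunDeriv (greenArg x y s)
      + 1 / 4 * riemannFun (greenArg x y s) : ℝ)) : ℂ) = 0 := by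
    rw [riemannFun_ode hm]; simp
  refine (((hid.pow 2).const_sub 1).mul ((((hasDerivAt_cos_comp hl).mul d1).mul
    (hid.mul_const (((x - y : ℝ) : ℂ) / (2 * x ^ 2)))).add
    (((hasDerivAt_sin_comp hl).const_mul k).mul d0))).congr_deriv ?_
  simp only [Function.comp, Pi.mul_apply, Pi.add_apply, Pi.pow_apply, greenKernelDerivTwo,
    greenKernel]
  have hxc : (x : ℂ) ≠ 0 := by exact_mod_cast hx.ne'
  have hyc : (y : ℂ) ≠ 0 := by exact_mod_cast hy.ne'
  clear d0 d1 hm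
  generalize riemannFunDerivTwo (greenArg x y s) = F2 at *
  generalize riemannFunDeriv (greenArg x y s) = F1 at *
  generalize riemannFun (greenArg x y s) = F0 at *
  generalize Complex.cos (k * (x - y : ℝ) * s) = c at *
  generalize Complex.sin (k * (x - y : ℝ) * s) = σ at *
  simp only [greenArg] at hode
  push_cast at hode ⊢
  -- The trigonometric factors match identically; what remains is a multiple of the hypergeometric
  -- equation for the Riemann function.
  linear_combination (norm := skip) (-(((x : ℂ) - y) * c / x ^ 2)) * hode
  field_simp
  ring

/-- Integrate `hasDerivAt_greenKernel_flux` over $[0,1]$: the flux vanishes at $s=1$ through the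
factor $1-s^2$, and at $s=0$ through $s$ and $\sin 0$. -/
lemma hasDerivAt_greenRepDeriv (k : ℂ) {x y : ℝ} (hx : 0 < x) (hy : 0 < y) :
    HasDerivAt (greenRepDeriv k y) (-(k ^ 2 + 1 / (4 * (x : ℂ) ^ 2)) * greenRep k y x) x := by
  refine (hasDerivAt_intervalIntegral_of_continuousOn (f := greenKernelDeriv k y)
    (f' := greenKernelDerivTwo k y) isOpen_Ioi zero_le_one
    (fun _ hx => (continuousOn_greenKernelDeriv k hy).slice_right hx)
    (continuousOn_greenKernelDerivTwo k hy)
    (fun _ hx _ hs => hasDerivAt_greenKernelDeriv k hx hy hs) hx).congr_deriv ?_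
  have cf := (continuousOn_greenKernelDerivTwo k hy).slice_right hx
  have ch := ((continuousOn_greenKernel k hy).slice_right hx).const_mul
    (k ^ 2 + 1 / (4 * (x : ℂ) ^ 2))
  have hI := intervalIntegral.integral_eq_sub_of_hasDerivAt
    (fun s hs => hasDerivAt_greenKernel_flux k hx hy (uIcc_of_le (zero_le_one' ℝ) ▸ hs))
    ((cf.add ch).intervalIntegrable_of_Icc zero_le_one)
  have hII := intervalIntegral.integral_add (cf.intervalIntegrable_of_Icc (μ := volume)
    zero_le_one) (ch.intervalIntegrable_of_Icc (μ := volume) zero_le_one)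
  rw [hII, intervalIntegral.integral_const_mul] at hI
  simp only [Complex.ofReal_one, Complex.ofReal_zero, one_pow, sub_self, zero_mul, mul_zero,
    Complex.sin_zero, add_zero] at hI
  rw [neg_mul, greenRep]
  exact eq_neg_of_add_eq_zero_left hI

/-! ### Entire power series and the Bessel equation in the variable $\zeta=-w^2/4$. -/

/-- Coefficient sequences dominated by a multiple of those of the exponential series. -/
def ExpBounded (c : ℕ → ℂ) : Prop := ∃ M : ℝ, ∀ n, ‖c n‖ ≤ M / n.factorial

/-- The coefficients of the derivative of a power series. -/
def derivCoeff (c : ℕ → ℂ) (n : ℕ) : ℂ := (n + 1) * c (n + 1)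

/-- The sum of the power series with given coefficients. -/
noncomputable def powerSum (c : ℕ → ℂ) (ζ : ℂ) : ℂ := ∑' n, c n * ζ ^ n

lemma ExpBounded.derivCoeff {c : ℕ → ℂ} (hc : ExpBounded c) : ExpBounded (derivCoeff c) := by
  obtain ⟨M, hM⟩ := hc
  refine ⟨M, fun n => ?_⟩
  have h1 : ‖((n : ℂ) + 1)‖ = n + 1 := by
    have := Complex.norm_natCast (n + 1)
    push_cast at this; exact this
  rw [_root_.derivCoeff, norm_mul, h1]
  have h2 := mul_le_mul_of_nonneg_left (hM (n + 1)) (show (0 : ℝ) ≤ n + 1 by positivity)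
  refine h2.trans (le_of_eq ?_)
  rw [Nat.factorial_succ]
  push_cast
  field_simp

lemma summable_div_factorial_mul_pow (M R : ℝ) :
    Summable fun n : ℕ => M / n.factorial * R ^ n := by
  refine ((Real.summable_pow_div_factorial R).mul_left M).congr fun n => ?_
  ring

lemma ExpBounded.summable {c : ℕ → ℂ} (hc : ExpBounded c) (ζ : ℂ) :
    Summable fun n => c n * ζ ^ n := by
  obtain ⟨M, hM⟩ := hc
  refine Summable.of_norm_bounded (summable_div_factorial_mul_pow M ‖ζ‖) fun n => ?_
  rw [norm_mul, norm_pow]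
  exact mul_le_mul_of_nonneg_right (hM n) (by positivity)

lemma ExpBounded.hasDerivAt {c : ℕ → ℂ} (hc : ExpBounded c) (ζ : ℂ) :
    HasDerivAt (powerSum c) (powerSum (_root_.derivCoeff c) ζ) ζ := by
  have hs := hc.summable 0
  have hs' := hc.derivCoeff.summable ζ
  obtain ⟨M, hM⟩ := hc.derivCoeff
  -- Any radius beyond $|\zeta|$ works: termwise differentiation is done on the ball of radius $R$
  -- about $0$.
  set R := ‖ζ‖ + 1
  have hu : Summable fun n : ℕ => ‖c n‖ * (n * R ^ (n - 1)) := by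
    rw [← summable_nat_add_iff 1]
    refine Summable.of_nonneg_of_le (fun n => by positivity) (fun n => ?_)
      (summable_div_factorial_mul_pow M R)
    have h1 : ‖((n : ℂ) + 1)‖ = n + 1 := by
      have := Complex.norm_natCast (n + 1)
      push_cast at this; exact this
    have h2 := hM n
    rw [_root_.derivCoeff, norm_mul, h1] at h2
    have h3 := mul_le_mul_of_nonneg_right h2 (show 0 ≤ R ^ n by positivity)
    simp only [Nat.add_sub_cancel]
    push_cast
    linarith
  have h := hasDerivAt_tsum_of_isPreconnected (𝕜 := ℂ) hu (Metric.isOpen_ball (x := (0 : ℂ)) (ε := R))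
    (convex_ball 0 R).isPreconnected (g := fun n z => c n * z ^ n)
    (g' := fun n z => c n * (n * z ^ (n - 1)))
    (fun n y _ => (hasDerivAt_pow n y).const_mul (c n))
    (fun n y hy => by
      rw [norm_mul, norm_mul, norm_pow, Complex.norm_natCast]
      have : ‖y‖ ≤ R := (mem_ball_zero_iff.1 hy).le
      gcongr)
    (y₀ := 0) (y := ζ) (Metric.mem_ball_self (by positivity)) hs
    (by simp [R])
  refine h.congr_deriv ?_
  rw [tsum_eq_zero_add' ?_]
  · simp only [Nat.cast_zero, zero_mul, mul_zero, zero_add, Nat.add_sub_cancel, powerSum,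
      _root_.derivCoeff]
    refine tsum_congr fun n => ?_
    push_cast; ring
  · refine hs'.congr fun n => ?_
    simp only [_root_.derivCoeff, Nat.add_sub_cancel]
    push_cast; ring

/-- The operator `f ↦ ζ f'' + f'` on coefficients. -/
lemma ExpBounded.mul_deriv_two_add_deriv {c : ℕ → ℂ} (hc : ExpBounded c) (ζ : ℂ) :
    ζ * powerSum (_root_.derivCoeff (_root_.derivCoeff c)) ζ + powerSum (_root_.derivCoeff c) ζ =
      powerSum (fun n => (n + 1) ^ 2 * c (n + 1)) ζ := by
  have s1 := hc.derivCoeff.summable ζ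
  have s2 := (hc.derivCoeff.derivCoeff.summable ζ).mul_left ζ
  have s3 : Summable fun n : ℕ => n * _root_.derivCoeff c n * ζ ^ n := by
    rw [← summable_nat_add_iff 1]
    refine s2.congr fun n => ?_
    simp only [_root_.derivCoeff]; push_cast; ring
  have e : ζ * powerSum (_root_.derivCoeff (_root_.derivCoeff c)) ζ =
      ∑' n : ℕ, n * _root_.derivCoeff c n * ζ ^ n := by
    rw [s3.tsum_eq_zero_add, powerSum, ← tsum_mul_left]
    simp only [Nat.cast_zero, zero_mul, zero_add]
    refine tsum_congr fun n => ?_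
    simp only [_root_.derivCoeff]; push_cast; ring
  rw [e, powerSum, powerSum, ← s3.tsum_add s1]
  refine tsum_congr fun n => ?_
  simp only [_root_.derivCoeff]; ring

/-- Coefficients of `J₀` as a series in `-w²/4`. -/
noncomputable def besselCoeff (n : ℕ) : ℂ := 1 / (n.factorial : ℂ) ^ 2

/-- Coefficients of the entire part of `Y₀` as a series in `-w²/4`. -/
noncomputable def neumannCoeff (n : ℕ) : ℂ :=
  Complex.digamma ((n : ℂ) + 1) / (n.factorial : ℂ) ^ 2

lemma digamma_succ (n : ℕ) :
    Complex.digamma (((n + 1 : ℕ) : ℂ) + 1) = Complex.digamma ((n : ℂ) + 1) + 1 / ((n : ℂ) + 1) := by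
  have h := Complex.digamma_apply_add_one ((n : ℂ) + 1) fun m hm => by
    have : ((n + 1 + m : ℕ) : ℂ) = 0 := by push_cast; rw [hm]; ring
    rw [Nat.cast_eq_zero] at this
    omega
  push_cast
  rw [h, one_div]

/-- Linear growth, though far from sharp, is enough: one of the two factorials in `neumannCoeff`
absorbs it. -/
lemma norm_digamma_le (n : ℕ) : ‖Complex.digamma ((n : ℂ) + 1)‖ ≤ n + 1 := by
  induction n with
  | zero =>
    have h1 := Real.eulerMascheroniConstant_lt_two_thirds
    have h2 := Real.one_half_lt_eulerMascheroniConstant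
    simp only [Nat.cast_zero, zero_add, Complex.digamma_one, norm_neg, Complex.norm_real,
      Real.norm_eq_abs]
    rw [abs_of_pos (by linarith)]
    linarith
  | succ n ih =>
    rw [digamma_succ]
    refine (norm_add_le _ _).trans ?_
    have h1 : ‖((n : ℂ) + 1)‖ = n + 1 := by
      have := Complex.norm_natCast (n + 1)
      push_cast at this; exact this
    rw [norm_div, h1, norm_one]
    have : 1 / ((n : ℝ) + 1) ≤ 1 := by
      rw [div_le_one (by positivity)]; linarith [n.cast_nonneg (α := ℝ)]
    push_cast
    linarith

lemma expBounded_besselCoeff : ExpBounded besselCoeff := by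
  refine ⟨1, fun n => ?_⟩
  have h : (1 : ℝ) ≤ n.factorial := by exact_mod_cast Nat.factorial_pos n
  rw [besselCoeff, norm_div, norm_pow, Complex.norm_natCast, norm_one]
  gcongr
  nlinarith

lemma expBounded_neumannCoeff : ExpBounded neumannCoeff := by
  refine ⟨2, fun n => ?_⟩
  have h : (1 : ℝ) ≤ n.factorial := by exact_mod_cast Nat.factorial_pos n
  have h2 : (n : ℝ) ≤ n.factorial := by exact_mod_cast Nat.self_le_factorial n
  rw [neumannCoeff, norm_div, norm_pow, Complex.norm_natCast, div_le_div_iff₀ (by positivity)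
    (by positivity)]
  have h3 := norm_digamma_le n
  have h4 : ‖Complex.digamma ((n : ℂ) + 1)‖ ≤ 2 * n.factorial := by linarith
  have := mul_le_mul_of_nonneg_right h4 (show (0 : ℝ) ≤ n.factorial by positivity)
  linarith

/-- `J₀(w)` as a function of `-w²/4`. -/
noncomputable def besselA (ζ : ℂ) : ℂ := powerSum besselCoeff ζ

/-- The derivative of `besselA`. -/
noncomputable def besselA' (ζ : ℂ) : ℂ := powerSum (derivCoeff besselCoeff) ζ

/-- The second derivative of `besselA`. -/
noncomputable def besselA'' (ζ : ℂ) : ℂ := powerSum (derivCoeff (derivCoeff besselCoeff)) ζ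

/-- The entire part of `Y₀(w)` as a function of `-w²/4`. -/
noncomputable def besselB (ζ : ℂ) : ℂ := powerSum neumannCoeff ζ

/-- The derivative of `besselB`. -/
noncomputable def besselB' (ζ : ℂ) : ℂ := powerSum (derivCoeff neumannCoeff) ζ

/-- The second derivative of `besselB`. -/
noncomputable def besselB'' (ζ : ℂ) : ℂ := powerSum (derivCoeff (derivCoeff neumannCoeff)) ζ

lemma hasDerivAt_besselA (ζ : ℂ) : HasDerivAt besselA (besselA' ζ) ζ :=
  expBounded_besselCoeff.hasDerivAt ζ

lemma hasDerivAt_besselA' (ζ : ℂ) : HasDerivAt besselA' (besselA'' ζ) ζ :=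
  expBounded_besselCoeff.derivCoeff.hasDerivAt ζ

lemma hasDerivAt_besselB (ζ : ℂ) : HasDerivAt besselB (besselB' ζ) ζ :=
  expBounded_neumannCoeff.hasDerivAt ζ

lemma hasDerivAt_besselB' (ζ : ℂ) : HasDerivAt besselB' (besselB'' ζ) ζ :=
  expBounded_neumannCoeff.derivCoeff.hasDerivAt ζ

/-- On coefficients this is $(n+1)^2c_{n+1}=c_n$. -/
lemma besselA_ode (ζ : ℂ) : ζ * besselA'' ζ + besselA' ζ = besselA ζ := by
  rw [besselA, besselA', besselA'', expBounded_besselCoeff.mul_deriv_two_add_deriv]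
  congr 1
  funext n
  have h1 : ((n : ℂ) + 1) ≠ 0 := Nat.cast_add_one_ne_zero n
  have h2 : (n.factorial : ℂ) ≠ 0 := by exact_mod_cast n.factorial_ne_zero
  simp only [besselCoeff, Nat.factorial_succ]
  push_cast
  field_simp

/-- The inhomogeneity comes from $\psi(n+2)=\psi(n+1)+\frac1{n+1}$. It later cancels the terms
produced by differentiating the logarithm in the singular solution. -/
lemma besselB_ode (ζ : ℂ) :
    ζ * besselB'' ζ + besselB' ζ = besselB ζ + besselA' ζ := by
  rw [besselB, besselB', besselB'', besselA', expBounded_neumannCoeff.mul_deriv_two_add_deriv,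
    powerSum, powerSum, powerSum, ← (expBounded_neumannCoeff.summable ζ).tsum_add
    (expBounded_besselCoeff.derivCoeff.summable ζ)]
  refine tsum_congr fun n => ?_
  have h1 : ((n : ℂ) + 1) ≠ 0 := Nat.cast_add_one_ne_zero n
  have h2 : (n.factorial : ℂ) ≠ 0 := by exact_mod_cast n.factorial_ne_zero
  simp only [besselCoeff, neumannCoeff, derivCoeff, Nat.factorial_succ, digamma_succ]
  push_cast
  field_simp

lemma powerSum_zero (c : ℕ → ℂ) : powerSum c 0 = c 0 := by
  rw [powerSum, tsum_eq_single 0 fun n hn => by simp [hn] ]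
  simp

lemma besselA_zero : besselA 0 = 1 := by simp [besselA, powerSum_zero, besselCoeff]

lemma besselB_zero : besselB 0 = -(Real.eulerMascheroniConstant : ℂ) := by
  simp [besselB, powerSum_zero, neumannCoeff, Complex.digamma_one]

/-- The Wronskian of `J₀` and `Y₀`. -/
lemma bessel_wronskian (ζ : ℂ) :
    besselA ζ ^ 2 + 2 * ζ * (besselA' ζ * besselB ζ - besselA ζ * besselB' ζ) = 1 := by
  have hd : ∀ ζ, HasDerivAt (fun ζ => besselA ζ ^ 2 +
      2 * ζ * (besselA' ζ * besselB ζ - besselA ζ * besselB' ζ)) 0 ζ := by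
    intro ζ
    have a := hasDerivAt_besselA ζ
    have a' := hasDerivAt_besselA' ζ
    have b := hasDerivAt_besselB ζ
    have b' := hasDerivAt_besselB' ζ
    refine ((a.pow 2).add (((hasDerivAt_id ζ).const_mul 2).mul
      ((a'.mul b).sub (a.mul b')))).congr_deriv ?_
    simp only [id, Pi.mul_apply, Pi.sub_apply]
    push_cast
    linear_combination 2 * besselB ζ * besselA_ode ζ - 2 * besselA ζ * besselB_ode ζ
  have h := is_const_of_deriv_eq_zero (fun ζ => (hd ζ).differentiableAt)
    (fun ζ => (hd ζ).deriv) ζ 0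
  simp only [besselA_zero] at h
  rw [h]; simp

/-! ### The solutions $\phi$, $\theta$ and $G$ as entire functions of $z$. -/

/-- The argument of the Bessel series in terms of the spectral parameter. -/
noncomputable def seriesArg (z : ℂ) (x : ℝ) : ℂ := -z * (x : ℂ) ^ 2 / 4

/-- Only the square of $\sqrt z$ enters, so the branch plays no role. -/
lemma besselJZero_eq (z : ℂ) (x : ℝ) :
    besselJZero (z ^ (1 / 2 : ℂ) * x) = besselA (seriesArg z x) := by
  have h : (z ^ (1 / 2 : ℂ)) ^ 2 = z := by simp
  rw [besselJZero, besselA, powerSum]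
  refine tsum_congr fun n => ?_
  rw [mul_pow, h, besselCoeff, seriesArg]
  ring

lemma freePhi_eq (z : ℂ) (x : ℝ) :
    freePhi z x = Real.sqrt (Real.pi * x / 2) * besselA (seriesArg z x) := by
  rw [freePhi, besselJZero_eq]

lemma log_cpow_half {z : ℂ} (hz : z ≠ 0) : Complex.log (z ^ (1 / 2 : ℂ)) = Complex.log z / 2 := by
  have h := Complex.arg_mem_Ioc z
  rw [Complex.cpow_def_of_ne_zero hz, Complex.log_exp]
  · ring
  all_goals
    simp [Complex.mul_im, Complex.log_im]
    have := Real.pi_pos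
    linarith [h.1, h.2]

/-- Since $\log(\sqrt z\,x/2)=\log(x/2)+\frac12\log z$ on principal branches, the $\log z$ terms
cancel. The prescribed value at $z=0$ fits because `besselB` equals $-\gamma$ there. -/
lemma freeTheta_eq (z : ℂ) {x : ℝ} (hx : 0 < x) :
    freeTheta z x = Real.sqrt (Real.pi * x / 2) * (2 / Real.pi) *
      (-(Real.log (x / 2) : ℂ) * besselA (seriesArg z x) + besselB (seriesArg z x)) := by
  have hπ := Real.pi_pos
  have hπc : (Real.pi : ℂ) ≠ 0 := by exact_mod_cast hπ.ne'
  rw [freeTheta]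
  split_ifs with hz
  · have e : Real.sqrt (2 * x / Real.pi) = Real.sqrt (Real.pi * x / 2) * (2 / Real.pi) := by
      have : 2 * x / Real.pi = (Real.pi * x / 2) * (2 / Real.pi) ^ 2 := by field_simp
      rw [this, Real.sqrt_mul (by positivity), Real.sqrt_sq (by positivity)]
    simp only [hz, seriesArg, neg_zero, zero_mul, zero_div, besselA_zero, besselB_zero, e]
    push_cast
    ring
  · have hw : z ^ (1 / 2 : ℂ) ≠ 0 := by simp [Complex.cpow_eq_zero_iff, hz]
    have h1 : Complex.log (z ^ (1 / 2 : ℂ) * x / 2) = Real.log (x / 2) + Complex.log z / 2 := by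
      have : z ^ (1 / 2 : ℂ) * x / 2 = ((x / 2 : ℝ) : ℂ) * z ^ (1 / 2 : ℂ) := by
        push_cast; ring
      rw [this, Complex.log_ofReal_mul (by positivity) hw, log_cpow_half hz]
    have h2 : (∑' n : ℕ, Complex.digamma ((n : ℂ) + 1) *
        (-((z ^ (1 / 2 : ℂ) * x) ^ 2) / 4) ^ n / ((n.factorial : ℂ) ^ 2)) =
        besselB (seriesArg z x) := by
      have h : (z ^ (1 / 2 : ℂ)) ^ 2 = z := by simp
      rw [besselB, powerSum]
      refine tsum_congr fun n => ?_
      rw [mul_pow, h, neumannCoeff, seriesArg]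
      ring
    rw [besselYZero, h1, h2, besselJZero_eq]
    field_simp
    ring

/-- The $\log 2$ in $\log(x/2)$ adds a multiple of the regular solution to the singular one and
drops out of the antisymmetric expression; the constants $\frac\pi2\cdot\frac2\pi$ cancel. -/
lemma freeGreen_eq (z : ℂ) {x y : ℝ} (hx : 0 < x) (hy : 0 < y) :
    freeGreen z x y = Real.sqrt x * Real.sqrt y *
      (besselA (seriesArg z x) * (-(Real.log y : ℂ) * besselA (seriesArg z y) +
          besselB (seriesArg z y))
        - besselA (seriesArg z y) * (-(Real.log x : ℂ) * besselA (seriesArg z x) +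
          besselB (seriesArg z x))) := by
  have hπ := Real.pi_pos
  have hπc : (Real.pi : ℂ) ≠ 0 := by exact_mod_cast hπ.ne'
  have e : ∀ t : ℝ, 0 < t → Real.sqrt (Real.pi * t / 2) = Real.sqrt (Real.pi / 2) * Real.sqrt t := by
    intro t ht
    rw [← Real.sqrt_mul (by positivity)]; congr 1; ring
  have e2 : ((Real.sqrt (Real.pi / 2) : ℝ) : ℂ) ^ 2 = Real.pi / 2 := by
    rw [← Complex.ofReal_pow, Real.sq_sqrt (by positivity)]; push_cast; ring
  rw [freeGreen, freePhi_eq, freePhi_eq, freeTheta_eq z hx, freeTheta_eq z hy, e x hx, e y hy,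
    Real.log_div hx.ne' two_ne_zero, Real.log_div hy.ne' two_ne_zero]
  push_cast
  have e3 : ((Real.sqrt (Real.pi / 2) : ℝ) : ℂ) ^ 2 * (2 / Real.pi) = 1 := by
    rw [e2]; field_simp
  linear_combination (Real.sqrt x * Real.sqrt y *
      (besselA (seriesArg z x) * (-(Real.log y : ℂ) * besselA (seriesArg z y) +
          besselB (seriesArg z y))
        - besselA (seriesArg z y) * (-(Real.log x : ℂ) * besselA (seriesArg z x) +
          besselB (seriesArg z x)))) * e3

/-! ### Normal form, Wronskians and identification of the Green's function. -/

lemma hasDerivAt_ofReal_sqrt {x : ℝ} (hx : 0 < x) :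
    HasDerivAt (fun x : ℝ => (Real.sqrt x : ℂ)) (Real.sqrt x / (2 * x) : ℂ) x := by
  refine (Real.hasDerivAt_sqrt hx.ne').ofReal_comp.congr_deriv ?_
  have h : Real.sqrt x ≠ 0 := (Real.sqrt_pos.2 hx).ne'
  have h2 : 1 / (2 * Real.sqrt x) = Real.sqrt x / (2 * x) := by
    field_simp; rw [Real.sq_sqrt hx.le]
  rw [h2]; push_cast; ring

/-- Passing to the Liouville normal form of the Bessel equation. -/
lemma hasDerivAt_sqrt_mul_normal_form {z : ℂ} {u u' : ℝ → ℂ} {x : ℝ} (hx : 0 < x)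
    (hu : HasDerivAt u (u' x) x) (hu' : HasDerivAt u' (-(u' x) / x - z * u x) x) :
    HasDerivAt (fun x : ℝ => (Real.sqrt x : ℂ) * u x) (Real.sqrt x * (u' x + u x / (2 * x))) x ∧
    HasDerivAt (fun x : ℝ => (Real.sqrt x : ℂ) * (u' x + u x / (2 * x)))
      (-(z + 1 / (4 * (x : ℂ) ^ 2)) * (Real.sqrt x * u x)) x := by
  have hs := hasDerivAt_ofReal_sqrt hx
  have hxc : (x : ℂ) ≠ 0 := by exact_mod_cast hx.ne'
  have hid : HasDerivAt (fun x : ℝ => 2 * (x : ℂ)) 2 x := by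
    simpa using ((hasDerivAt_id x).ofReal_comp).const_mul (2 : ℂ)
  refine ⟨(hs.mul hu).congr_deriv ?_,
    (hs.mul (hu'.add (hu.div hid (by simpa using hxc)))).congr_deriv ?_⟩
  · field_simp; ring
  · simp only [Pi.add_apply, Pi.div_apply]
    field_simp; ring

/-- Lagrange's identity: the Wronskian of two solutions of the same equation is constant. -/
lemma wronskian_const {q u u' v v' : ℝ → ℂ}
    (hu : ∀ x, 0 < x → HasDerivAt u (u' x) x) (hu' : ∀ x, 0 < x → HasDerivAt u' (-q x * u x) x)
    (hv : ∀ x, 0 < x → HasDerivAt v (v' x) x) (hv' : ∀ x, 0 < x → HasDerivAt v' (-q x * v x) x)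
    {x y : ℝ} (hx : 0 < x) (hy : 0 < y) :
    u x * v' x - u' x * v x = u y * v' y - u' y * v y := by
  have hd : ∀ x, 0 < x → HasDerivAt (fun x => u x * v' x - u' x * v x) 0 x := fun x hx =>
    (((hu x hx).mul (hv' x hx)).sub ((hu' x hx).mul (hv x hx))).congr_deriv (by ring)
  exact isOpen_Ioi.is_const_of_deriv_eq_zero isPreconnected_Ioi
    (fun x hx => (hd x hx).differentiableAt.differentiableWithinAt)
    (fun x hx => (hd x hx).deriv) hx hy

lemma hasDerivAt_seriesArg (z : ℂ) (x : ℝ) :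
    HasDerivAt (seriesArg z) (-z * x / 2) x := by
  have h : HasDerivAt (fun x : ℝ => (x : ℂ)) 1 x := (hasDerivAt_id x).ofReal_comp
  refine (((h.pow 2).const_mul (-z)).div_const 4).congr_deriv ?_
  push_cast; ring

lemma hasDerivAt_besselA_seriesArg (z : ℂ) {x : ℝ} (hx : 0 < x) :
    HasDerivAt (fun x => besselA (seriesArg z x)) (-z * x / 2 * besselA' (seriesArg z x)) x ∧
    HasDerivAt (fun x : ℝ => -z * x / 2 * besselA' (seriesArg z x))
      (-(-z * x / 2 * besselA' (seriesArg z x)) / x - z * besselA (seriesArg z x)) x := by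
  have hxc : (x : ℂ) ≠ 0 := by exact_mod_cast hx.ne'
  have h : HasDerivAt (fun x : ℝ => (x : ℂ)) 1 x := (hasDerivAt_id x).ofReal_comp
  have hs := hasDerivAt_seriesArg z x
  have hode := besselA_ode (seriesArg z x)
  have hz : seriesArg z x = -z * x ^ 2 / 4 := rfl
  refine ⟨((hasDerivAt_besselA _).comp x hs).congr_deriv (by ring),
    (((h.const_mul (-z)).div_const 2).mul ((hasDerivAt_besselA' _).comp x hs)).congr_deriv ?_⟩
  simp only [Function.comp]
  generalize seriesArg z x = ζ at *
  rw [← hode]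
  nth_rw 4 [hz]
  field_simp
  ring

lemma hasDerivAt_besselB_seriesArg (z : ℂ) {x : ℝ} (hx : 0 < x) :
    HasDerivAt (fun x : ℝ => -(Real.log x : ℂ) * besselA (seriesArg z x) + besselB (seriesArg z x))
      (-besselA (seriesArg z x) / x - Real.log x * (-z * x / 2 * besselA' (seriesArg z x)) +
        -z * x / 2 * besselB' (seriesArg z x)) x ∧
    HasDerivAt (fun x : ℝ => -besselA (seriesArg z x) / x -
        Real.log x * (-z * x / 2 * besselA' (seriesArg z x)) +
        -z * x / 2 * besselB' (seriesArg z x))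
      (-(-besselA (seriesArg z x) / x - Real.log x * (-z * x / 2 * besselA' (seriesArg z x)) +
        -z * x / 2 * besselB' (seriesArg z x)) / x -
        z * (-(Real.log x : ℂ) * besselA (seriesArg z x) + besselB (seriesArg z x))) x := by
  have hxc : (x : ℂ) ≠ 0 := by exact_mod_cast hx.ne'
  have h : HasDerivAt (fun x : ℝ => (x : ℂ)) 1 x := (hasDerivAt_id x).ofReal_comp
  have hl := (Real.hasDerivAt_log hx.ne').ofReal_comp
  have hs := hasDerivAt_seriesArg z x
  have hode := besselB_ode (seriesArg z x)
  have hz : seriesArg z x = -z * x ^ 2 / 4 := rfl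
  obtain ⟨ha, ha'⟩ := hasDerivAt_besselA_seriesArg z hx
  refine ⟨((hl.neg.mul ha).add ((hasDerivAt_besselB _).comp x hs)).congr_deriv ?_,
    (((ha.neg.div h hxc).sub (hl.mul ha')).add
    (((h.const_mul (-z)).div_const 2).mul ((hasDerivAt_besselB' _).comp x hs))).congr_deriv ?_⟩
  · simp only [Pi.neg_apply]
    push_cast
    ring
  simp only [Function.comp, Pi.neg_apply]
  generalize seriesArg z x = ζ at *
  have hB : besselB ζ = -z * x ^ 2 / 4 * besselB'' ζ + besselB' ζ - besselA' ζ := by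
    rw [← hz]; linear_combination -hode
  rw [hB]
  push_cast
  field_simp
  ring

/-- The regular solution of the free equation in normal form. -/
noncomputable def regularSol (z : ℂ) (x : ℝ) : ℂ := Real.sqrt x * besselA (seriesArg z x)

/-- The derivative of `regularSol`. -/
noncomputable def regularSolDeriv (z : ℂ) (x : ℝ) : ℂ :=
  Real.sqrt x * (-z * x / 2 * besselA' (seriesArg z x) + besselA (seriesArg z x) / (2 * x))

/-- A singular solution of the free equation in normal form. -/
noncomputable def singularSol (z : ℂ) (x : ℝ) : ℂ :=
  Real.sqrt x * (-(Real.log x : ℂ) * besselA (seriesArg z x) + besselB (seriesArg z x))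

/-- The derivative of `singularSol`. -/
noncomputable def singularSolDeriv (z : ℂ) (x : ℝ) : ℂ :=
  Real.sqrt x * (-besselA (seriesArg z x) / x
    - Real.log x * (-z * x / 2 * besselA' (seriesArg z x))
    + -z * x / 2 * besselB' (seriesArg z x)
    + (-(Real.log x : ℂ) * besselA (seriesArg z x) + besselB (seriesArg z x)) / (2 * x))

lemma hasDerivAt_regularSol (z : ℂ) {x : ℝ} (hx : 0 < x) :
    HasDerivAt (regularSol z) (regularSolDeriv z x) x ∧
    HasDerivAt (regularSolDeriv z) (-(z + 1 / (4 * (x : ℂ) ^ 2)) * regularSol z x) x :=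
  hasDerivAt_sqrt_mul_normal_form (u := fun x => besselA (seriesArg z x))
    (u' := fun x : ℝ => -z * x / 2 * besselA' (seriesArg z x)) hx
    (hasDerivAt_besselA_seriesArg z hx).1 (hasDerivAt_besselA_seriesArg z hx).2

lemma hasDerivAt_singularSol (z : ℂ) {x : ℝ} (hx : 0 < x) :
    HasDerivAt (singularSol z) (singularSolDeriv z x) x ∧
    HasDerivAt (singularSolDeriv z) (-(z + 1 / (4 * (x : ℂ) ^ 2)) * singularSol z x) x :=
  hasDerivAt_sqrt_mul_normal_form
    (u := fun x => -(Real.log x : ℂ) * besselA (seriesArg z x) + besselB (seriesArg z x))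
    (u' := fun x : ℝ => -besselA (seriesArg z x) / x
      - Real.log x * (-z * x / 2 * besselA' (seriesArg z x))
      + -z * x / 2 * besselB' (seriesArg z x)) hx
    (hasDerivAt_besselB_seriesArg z hx).1 (hasDerivAt_besselB_seriesArg z hx).2

/-- The logarithmic terms cancel and `bessel_wronskian` at $\zeta=-zx^2/4$ is left. -/
lemma regularSol_singularSol_wronskian (z : ℂ) {x : ℝ} (hx : 0 < x) :
    regularSolDeriv z x * singularSol z x - singularSolDeriv z x * regularSol z x = 1 := by
  have hxc : (x : ℂ) ≠ 0 := by exact_mod_cast hx.ne'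
  have hsq : (Real.sqrt x : ℂ) ^ 2 = x := by rw [← Complex.ofReal_pow, Real.sq_sqrt hx.le]
  have hw := bessel_wronskian (seriesArg z x)
  have hz : seriesArg z x = -z * x ^ 2 / 4 := rfl
  simp only [regularSolDeriv, singularSolDeriv, regularSol, singularSol]
  generalize besselA (seriesArg z x) = A at *
  generalize besselA' (seriesArg z x) = A' at *
  generalize besselB (seriesArg z x) = B at *
  generalize besselB' (seriesArg z x) = B' at *
  rw [hz] at hw
  generalize (Real.log x : ℂ) = l
  generalize (Real.sqrt x : ℂ) = r at *
  generalize (x : ℂ) = X at *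
  subst hsq
  have hr : r ≠ 0 := by rintro rfl; simp at hxc
  refine Eq.trans ?_ hw
  field_simp
  ring

/-- The integral representation of the free Green's function. -/
theorem freeGreen_eq_greenRep (k : ℂ) {x y : ℝ} (hx : 0 < x) (hy : 0 < y) :
    freeGreen (k ^ 2) x y = greenRep k y x := by
  -- Constancy of the Wronskian with each of two independent solutions carries the Cauchy data from
  -- $y$ to $x$.
  have wa := wronskian_const (u := greenRep k y) (v := regularSol (k ^ 2))
    (q := fun x : ℝ => k ^ 2 + 1 / (4 * (x : ℂ) ^ 2))
    (fun t ht => hasDerivAt_greenRep k ht hy) (fun t ht => hasDerivAt_greenRepDeriv k ht hy)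
    (fun t ht => (hasDerivAt_regularSol _ ht).1) (fun t ht => (hasDerivAt_regularSol _ ht).2) hx hy
  have wb := wronskian_const (u := greenRep k y) (v := singularSol (k ^ 2))
    (q := fun x : ℝ => k ^ 2 + 1 / (4 * (x : ℂ) ^ 2))
    (fun t ht => hasDerivAt_greenRep k ht hy) (fun t ht => hasDerivAt_greenRepDeriv k ht hy)
    (fun t ht => (hasDerivAt_singularSol _ ht).1) (fun t ht => (hasDerivAt_singularSol _ ht).2)
    hx hy
  have hw := regularSol_singularSol_wronskian (k ^ 2) hx
  rw [greenRep_self, greenRepDeriv_self, zero_mul, one_mul, zero_sub] at wa wb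
  have e : freeGreen (k ^ 2) x y = regularSol (k ^ 2) x * singularSol (k ^ 2) y
      - regularSol (k ^ 2) y * singularSol (k ^ 2) x := by
    rw [freeGreen_eq _ hx hy]
    simp only [regularSol, singularSol]
    ring
  rw [e]
  -- Cramer's rule: this eliminates `greenRepDeriv` and leaves `greenRep` times a Wronskian equal to
  -- $1$.
  linear_combination (-singularSol (k ^ 2) x) * wa + regularSol (k ^ 2) x * wb
    + greenRep k y x * hw

/-! ### Oscillatory integrals with monotone amplitude. -/

lemma norm_exp_mul_I_le (w : ℂ) : ‖Complex.exp (w * Complex.I)‖ ≤ Real.exp |w.im| := by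
  rw [Complex.norm_exp]
  simp only [Complex.mul_I_re]
  exact Real.exp_le_exp.2 (neg_le_abs _)

lemma norm_exp_neg_mul_I_le (w : ℂ) : ‖Complex.exp (-w * Complex.I)‖ ≤ Real.exp |w.im| := by
  simpa using norm_exp_mul_I_le (-w)

lemma norm_sin_le_exp (w : ℂ) : ‖Complex.sin w‖ ≤ Real.exp |w.im| := by
  have h := norm_sub_le (Complex.exp (-w * Complex.I)) (Complex.exp (w * Complex.I))
  rw [Complex.sin, norm_div, norm_mul, Complex.norm_I, Complex.norm_two, mul_one]
  linarith [norm_exp_mul_I_le w, norm_exp_neg_mul_I_le w]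

lemma norm_cos_le_exp (w : ℂ) : ‖Complex.cos w‖ ≤ Real.exp |w.im| := by
  have h := norm_add_le (Complex.exp (w * Complex.I)) (Complex.exp (-w * Complex.I))
  rw [Complex.cos, norm_div, Complex.norm_two]
  linarith [norm_exp_mul_I_le w, norm_exp_neg_mul_I_le w]

/-- Mean value inequality from $0$ to $w$ in the convex strip $|\mathrm{Im}\,z|\le|\mathrm{Im}\,w|$,
where $|\cos z|\le e^{|\mathrm{Im}\,w|}$. -/
lemma norm_sin_le_norm_mul_exp (w : ℂ) : ‖Complex.sin w‖ ≤ ‖w‖ * Real.exp |w.im| := by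
  have hconv : Convex ℝ {z : ℂ | |z.im| ≤ |w.im|} := by
    have : {z : ℂ | |z.im| ≤ |w.im|} = Complex.imLm ⁻¹' Icc (-|w.im|) |w.im| := by
      ext z; simp [abs_le]
    rw [this]
    exact (convex_Icc _ _).linear_preimage _
  have h := hconv.norm_image_sub_le_of_norm_deriv_le (f := Complex.sin) (C := Real.exp |w.im|)
    (fun z _ => Complex.differentiableAt_sin) (fun z hz => by
      rw [Complex.deriv_sin]
      exact (norm_cos_le_exp z).trans (Real.exp_le_exp.2 hz))
    (x := 0) (y := w) (by simp) (by simp)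
  simpa [mul_comm] using h

lemma abs_im_mul_ofReal_le (κ : ℂ) {s a : ℝ} (hs : 0 ≤ s) (hsa : s ≤ a) :
    |(κ * s).im| ≤ |κ.im| * a := by
  rw [Complex.im_mul_ofReal, abs_mul, abs_of_nonneg hs]
  gcongr

/-- Cancellation in an oscillatory integral with nondecreasing amplitude. -/
lemma norm_integral_mul_sin_le {g g' : ℝ → ℝ} {a : ℝ} (ha : 0 ≤ a)
    (hg : ∀ s ∈ Icc 0 a, HasDerivAt g (g' s) s) (hc : ContinuousOn g' (Icc 0 a))
    (h0 : ∀ s ∈ Icc 0 a, 0 ≤ g' s) (hg0 : 0 ≤ g 0) {κ : ℂ} (hκ : κ ≠ 0) :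
    ‖∫ s in (0 : ℝ)..a, (g s : ℂ) * Complex.sin (κ * s)‖ ≤
      2 * g a / ‖κ‖ * Real.exp (|κ.im| * a) := by
  have hu : uIcc 0 a = Icc 0 a := uIcc_of_le ha
  set e := Real.exp (|κ.im| * a)
  have hI : IntervalIntegrable g' volume 0 a := hc.intervalIntegrable_of_Icc ha
  have hlin : ∀ s : ℝ, HasDerivAt (fun s : ℝ => κ * s) κ s := fun s => by
    simpa using ((hasDerivAt_id s).ofReal_comp).const_mul κ
  have hv : ∀ s : ℝ, HasDerivAt (fun s : ℝ => -Complex.cos (κ * s) / κ)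
      (Complex.sin (κ * s)) s := fun s => by
    refine ((hasDerivAt_cos_comp (hlin s)).neg.div_const κ).congr_deriv ?_
    field_simp
  have hcos : ∀ s ∈ Icc 0 a, ‖-Complex.cos (κ * s) / κ‖ ≤ e / ‖κ‖ := fun s hs => by
    rw [norm_div, norm_neg]
    gcongr
    exact (norm_cos_le_exp _).trans (Real.exp_le_exp.2 (abs_im_mul_ofReal_le κ hs.1 hs.2))
  -- The boundary terms contribute $g(a)+g(0)$ and, by monotonicity, the remaining integral
  -- $g(a)-g(0)$; the sum is $2g(a)$.
  have hparts := intervalIntegral.integral_mul_deriv_eq_deriv_mul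
    (u := fun s => (g s : ℂ)) (u' := fun s => (g' s : ℂ)) (a := 0) (b := a)
    (fun s hs => (hg s (hu ▸ hs)).ofReal_comp) (fun s _ => hv s)
    ((Complex.continuous_ofReal.comp_continuousOn hc).intervalIntegrable_of_Icc ha)
    (Continuous.intervalIntegrable (by fun_prop) _ _)
  have hFTC : ∫ s in (0 : ℝ)..a, g' s = g a - g 0 :=
    intervalIntegral.integral_eq_sub_of_hasDerivAt (fun s hs => hg s (hu ▸ hs)) hI
  have hint : ‖∫ s in (0 : ℝ)..a, (g' s : ℂ) * (-Complex.cos (κ * s) / κ)‖ ≤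
      (g a - g 0) * (e / ‖κ‖) := by
    rw [← hFTC, ← intervalIntegral.integral_mul_const]
    refine intervalIntegral.norm_integral_le_of_norm_le ha (ae_of_all _ fun s hs => ?_)
      (hI.mul_const _)
    have hs' : s ∈ Icc 0 a := Ioc_subset_Icc_self hs
    rw [norm_mul, Complex.norm_real, Real.norm_of_nonneg (h0 s hs')]
    exact mul_le_mul_of_nonneg_left (hcos s hs') (h0 s hs')
  have hmono : g 0 ≤ g a := by
    have := intervalIntegral.integral_nonneg (μ := volume) ha h0
    linarith
  have hA : ‖(g a : ℂ) * (-Complex.cos (κ * a) / κ)‖ ≤ g a * (e / ‖κ‖) := by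
    rw [norm_mul, Complex.norm_real, Real.norm_of_nonneg (hg0.trans hmono)]
    exact mul_le_mul_of_nonneg_left (hcos a ⟨ha, le_rfl⟩) (hg0.trans hmono)
  have hB : ‖(g 0 : ℂ) * (-Complex.cos (κ * (0 : ℝ)) / κ)‖ ≤ g 0 * (e / ‖κ‖) := by
    rw [norm_mul, Complex.norm_real, Real.norm_of_nonneg hg0]
    exact mul_le_mul_of_nonneg_left (hcos 0 ⟨le_rfl, ha⟩) hg0
  rw [hparts]
  refine (norm_sub_le _ _).trans ((add_le_add (norm_sub_le _ _) le_rfl).trans ?_)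
  refine (add_le_add (add_le_add hA hB) hint).trans (le_of_eq ?_)
  ring

/-- An integral near an inverse square root singularity. -/
lemma norm_integral_le_of_le_inv_sqrt {h : ℝ → ℂ} {b Λ : ℝ} (hb1 : b ≤ 1)
    (hh : ∀ s ∈ Ico b 1, ‖h s‖ ≤ Λ / Real.sqrt (1 - s)) :
    ‖∫ s in b..1, h s‖ ≤ 2 * Λ * Real.sqrt (1 - b) := by
  have hi : IntervalIntegrable (fun u : ℝ => u ^ (-(1 / 2) : ℝ)) volume 0 (1 - b) :=
    intervalIntegral.intervalIntegrable_rpow' (by norm_num)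
  have hi' : IntervalIntegrable (fun s : ℝ => (1 - s) ^ (-(1 / 2) : ℝ)) volume b 1 := by
    have := (hi.comp_sub_left 1).symm
    simpa using this
  have hval : ∫ s in b..1, Λ * (1 - s) ^ (-(1 / 2) : ℝ) = 2 * Λ * Real.sqrt (1 - b) := by
    rw [intervalIntegral.integral_const_mul,
      intervalIntegral.integral_comp_sub_left (fun u : ℝ => u ^ (-(1 / 2) : ℝ)) 1,
      integral_rpow (Or.inl (by norm_num)), Real.sqrt_eq_rpow]
    norm_num
    ring
  rw [← hval]
  refine intervalIntegral.norm_integral_le_of_norm_le hb1 ?_ (hi'.const_mul Λ)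
  have hne : ∀ᵐ s : ℝ, s ≠ 1 := by simp [ae_iff, measure_singleton]
  filter_upwards [hne] with s hs1 hs
  have hlt : s < 1 := lt_of_le_of_ne hs.2 hs1
  refine (hh s ⟨hs.1.le, hlt⟩).trans (le_of_eq ?_)
  rw [Real.rpow_neg (by linarith), ← Real.sqrt_eq_rpow, div_eq_mul_inv]

/-- Decay of an oscillatory integral whose nondecreasing amplitude is controlled by an inverse
square root singularity. -/
lemma norm_integral_mul_sin_le_inv_sqrt {g g' : ℝ → ℝ} {Λ : ℝ}
    (hg : ∀ s ∈ Icc (0 : ℝ) 1, HasDerivAt g (g' s) s) (hc : ContinuousOn g' (Icc 0 1))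
    (h0 : ∀ s ∈ Icc (0 : ℝ) 1, 0 ≤ g' s) (hg0 : ∀ s ∈ Icc (0 : ℝ) 1, 0 ≤ g s)
    (hΛ : 0 ≤ Λ) (hgΛ : ∀ s ∈ Ico (0 : ℝ) 1, g s ≤ Λ / Real.sqrt (1 - s)) {κ : ℂ} (hκ : κ ≠ 0) :
    ‖∫ s in (0 : ℝ)..1, (g s : ℂ) * Complex.sin (κ * s)‖ ≤
      4 * Λ / Real.sqrt ‖κ‖ * Real.exp |κ.im| := by
  have hκ' : 0 < ‖κ‖ := norm_pos_iff.2 hκ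
  have hs0 : 0 < Real.sqrt ‖κ‖ := Real.sqrt_pos.2 hκ'
  have near : ∀ b ∈ Icc (0 : ℝ) 1, ‖∫ s in b..1, (g s : ℂ) * Complex.sin (κ * s)‖ ≤
      2 * (Λ * Real.exp |κ.im|) * Real.sqrt (1 - b) := fun b hb => by
    refine norm_integral_le_of_le_inv_sqrt hb.2 fun s hs => ?_
    have hs' : s ∈ Ico (0 : ℝ) 1 := ⟨hb.1.trans hs.1, hs.2⟩
    have hsin : ‖Complex.sin (κ * s)‖ ≤ Real.exp |κ.im| := by
      have := abs_im_mul_ofReal_le κ hs'.1 hs'.2.le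
      rw [mul_one] at this
      exact (norm_sin_le_exp _).trans (Real.exp_le_exp.2 this)
    rw [norm_mul, Complex.norm_real, Real.norm_of_nonneg (hg0 s (Ico_subset_Icc_self hs')),
      mul_div_right_comm]
    exact mul_le_mul (hgΛ s hs') hsin (norm_nonneg _) (by positivity)
  rcases le_or_gt 1 ‖κ‖ with h1 | h1
  -- This cut balances the two pieces: near the singularity $2\Lambda\sqrt{1-b}$, away from it
  -- $2g(b)/|\kappa|$ with $g(b)\le\Lambda\sqrt{|\kappa|}$. Each is at most
  -- $2\Lambda/\sqrt{|\kappa|}$, up to the exponential.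
  · set b := 1 - 1 / ‖κ‖
    have hinv : 1 / ‖κ‖ ≤ 1 := by rw [div_le_one hκ']; exact h1
    have hinv0 : 0 < 1 / ‖κ‖ := by positivity
    have hb : b ∈ Icc (0 : ℝ) 1 := ⟨by simp only [b]; linarith, by simp only [b]; linarith⟩
    have hb1 : 1 - b = 1 / ‖κ‖ := by simp [b]
    have hsub : Icc 0 b ⊆ Icc (0 : ℝ) 1 := Icc_subset_Icc_right hb.2
    have hcont : ContinuousOn (fun s : ℝ => (g s : ℂ) * Complex.sin (κ * s)) (Icc 0 1) :=
      ContinuousOn.mul (Complex.continuous_ofReal.comp_continuousOn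
        fun s hs => (hg s hs).continuousAt.continuousWithinAt) (by fun_prop)
    rw [← intervalIntegral.integral_add_adjacent_intervals
      ((hcont.mono hsub).intervalIntegrable_of_Icc hb.1)
      ((hcont.mono (Icc_subset_Icc_left hb.1)).intervalIntegrable_of_Icc hb.2)]
    have far := norm_integral_mul_sin_le hb.1 (fun s hs => hg s (hsub hs)) (hc.mono hsub)
      (fun s hs => h0 s (hsub hs)) (hg0 0 ⟨le_rfl, zero_le_one⟩) hκ
    have hgb : g b ≤ Λ * Real.sqrt ‖κ‖ := by
      have := hgΛ b ⟨hb.1, by linarith⟩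
      rwa [hb1, Real.sqrt_div zero_le_one, Real.sqrt_one, div_div_eq_mul_div, div_one] at this
    have hexp : Real.exp (|κ.im| * b) ≤ Real.exp |κ.im| :=
      Real.exp_le_exp.2 (mul_le_of_le_one_right (abs_nonneg _) hb.2)
    have hfar : 2 * g b / ‖κ‖ * Real.exp (|κ.im| * b) ≤
        2 * Λ / Real.sqrt ‖κ‖ * Real.exp |κ.im| := by
      have e : 2 * Λ / Real.sqrt ‖κ‖ = 2 * (Λ * Real.sqrt ‖κ‖) / ‖κ‖ := by
        nth_rw 3 [← Real.sq_sqrt hκ'.le]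
        field_simp
      rw [e]
      gcongr
    have hnear := near b hb
    rw [hb1, Real.sqrt_div zero_le_one, Real.sqrt_one] at hnear
    refine (norm_add_le _ _).trans ((add_le_add (far.trans hfar) hnear).trans (le_of_eq ?_))
    ring
  · have h2 := near 0 ⟨le_rfl, zero_le_one⟩
    rw [sub_zero, Real.sqrt_one, mul_one] at h2
    refine h2.trans ?_
    have h3 : Real.sqrt ‖κ‖ ≤ 1 := Real.sqrt_le_iff.2 ⟨zero_le_one, by linarith⟩
    have h4 : 2 * Λ ≤ 4 * Λ / Real.sqrt ‖κ‖ := by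
      rw [le_div_iff₀ hs0]
      nlinarith
    calc 2 * (Λ * Real.exp |κ.im|) = 2 * Λ * Real.exp |κ.im| := by ring
      _ ≤ _ := mul_le_mul_of_nonneg_right h4 (Real.exp_pos _).le

/-! ### The amplitude of the $k$-derivative. -/

/-- For $y\ge x/2$ the right side exceeds $1\ge F$. For $y<x/2$ the argument $m$ satisfies
$\frac{x}{16y}(1-s)\le m\le(x/y)^2$: the lower bound goes into the denominator of
`riemannFun_le_log`, the upper one into its logarithm. The constant is $6=\frac32\cdot4$, from
$\sqrt2\le\frac32$ and $\sqrt{16}$. -/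
lemma riemannFun_greenArg_le {x y s : ℝ} (hy : 0 < y) (hyx : y ≤ x) (hs : s ∈ Ico (0 : ℝ) 1) :
    riemannFun (greenArg x y s) ≤
      6 * (1 + Real.log (x / y)) * Real.sqrt (y / x) / Real.sqrt (1 - s) := by
  have hx : 0 < x := hy.trans_le hyx
  have hr : 1 ≤ x / y := by rwa [one_le_div hy]
  have hlog : 0 ≤ Real.log (x / y) := Real.log_nonneg hr
  have hs1 : 0 < 1 - s := by linarith [hs.2]
  have hsq : 0 < Real.sqrt (1 - s) := Real.sqrt_pos.2 hs1
  have hm0 := greenArg_nonneg hx hy (Ico_subset_Icc_self hs)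
  rcases le_or_gt (x / 2) y with h | h
  · refine (riemannFun_le_one hm0).trans ?_
    rw [le_div_iff₀ hsq, one_mul]
    have h1 : Real.sqrt (1 - s) ≤ 1 := Real.sqrt_le_iff.2 ⟨zero_le_one, by linarith [hs.1]⟩
    have h2 : 1 / 2 ≤ Real.sqrt (y / x) := by
      apply Real.le_sqrt_of_sq_le
      rw [le_div_iff₀ hx]; linarith
    nlinarith [mul_nonneg hlog (Real.sqrt_nonneg (y / x))]
  · have hm1 : (x / y) * (1 - s) / 16 ≤ greenArg x y s := by
      rw [greenArg, div_mul_eq_mul_div, div_div, div_le_div_iff₀ (by positivity) (by positivity)]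
      have h3 : x ^ 2 / 4 ≤ (x - y) ^ 2 := by nlinarith
      have h4 : 1 - s ≤ 1 - s ^ 2 := by nlinarith [hs.1]
      have h5 : x ^ 2 / 4 * (1 - s) ≤ (x - y) ^ 2 * (1 - s ^ 2) :=
        mul_le_mul h3 h4 hs1.le (sq_nonneg _)
      nlinarith [mul_le_mul_of_nonneg_left h5 (show 0 ≤ 16 * y by positivity)]
    have hm2 : greenArg x y s ≤ (x / y) ^ 2 := by
      have h3 : (x - y) ^ 2 ≤ x ^ 2 := by nlinarith
      have h4 : (x - y) ^ 2 * (1 - s ^ 2) ≤ x ^ 2 := by nlinarith [sq_nonneg (x - y), sq_nonneg s]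
      rw [greenArg, div_pow, div_le_div_iff₀ (by positivity) (by positivity)]
      have h5 := mul_le_mul_of_nonneg_right h4 (show 0 ≤ y ^ 2 by positivity)
      have h6 : x ^ 2 * y ^ 2 ≤ x ^ 2 * (4 * x * y) :=
        mul_le_mul_of_nonneg_left (by nlinarith) (by positivity)
      linarith
    have hmpos : 0 < greenArg x y s := lt_of_lt_of_le (by positivity) hm1
    refine (riemannFun_le_log hmpos).trans ?_
    have hsm : Real.sqrt (x / y) * Real.sqrt (1 - s) / 4 ≤ Real.sqrt (greenArg x y s) := by
      apply Real.le_sqrt_of_sq_le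
      rw [div_pow, mul_pow, Real.sq_sqrt (by positivity), Real.sq_sqrt hs1.le]
      linarith
    have hl : Real.log (1 + Real.sqrt (greenArg x y s)) ≤ 1 + Real.log (x / y) := by
      have h7 : Real.sqrt (greenArg x y s) ≤ x / y := Real.sqrt_le_iff.2 ⟨by positivity, hm2⟩
      calc Real.log (1 + Real.sqrt (greenArg x y s)) ≤ Real.log (2 * (x / y)) :=
            Real.log_le_log (by positivity) (by linarith)
        _ = Real.log 2 + Real.log (x / y) := Real.log_mul two_ne_zero (by positivity)
        _ ≤ _ := by linarith [Real.log_two_lt_d9]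
    have h2 : Real.sqrt 2 ≤ 3 / 2 := by
      rw [Real.sqrt_le_left (by norm_num)]; norm_num
    have hpos : 0 < Real.sqrt (x / y) * Real.sqrt (1 - s) / 4 := by
      have : 0 < Real.sqrt (x / y) := Real.sqrt_pos.2 (by positivity)
      positivity
    have hl0 : 0 ≤ Real.log (1 + Real.sqrt (greenArg x y s)) :=
      Real.log_nonneg (by linarith [Real.sqrt_nonneg (greenArg x y s)])
    calc Real.sqrt 2 * Real.log (1 + Real.sqrt (greenArg x y s)) / Real.sqrt (greenArg x y s)
        ≤ 3 / 2 * (1 + Real.log (x / y)) / (Real.sqrt (x / y) * Real.sqrt (1 - s) / 4) := by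
          gcongr
      _ = _ := by
        have : Real.sqrt (y / x) = 1 / Real.sqrt (x / y) := by
          rw [← inv_div x y, Real.sqrt_inv, one_div]
        have h9 : Real.sqrt (x / y) ≠ 0 := (Real.sqrt_pos.2 (by positivity)).ne'
        rw [this]
        field_simp
        norm_num

lemma hasDerivAt_greenRep_param (k : ℂ) {x y : ℝ} (hx : 0 < x) (hy : 0 < y) :
    HasDerivAt (fun k => greenRep k y x) (-(((x - y : ℝ) : ℂ) ^ 2 * ∫ s in (0 : ℝ)..1,
      ((s * riemannFun (greenArg x y s) : ℝ) : ℂ) * Complex.sin (k * (x - y : ℝ) * s))) k := by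
  have hF := continuousOn_comp_greenArg_right hx hy continuousOn_riemannFun
  have h := hasDerivAt_intervalIntegral_of_continuousOn (𝕜 := ℂ) (E := ℂ) isOpen_univ
    (zero_le_one' ℝ) (f := fun k s => greenKernel k y x s)
    (f' := fun k s => (-((x - y : ℝ) : ℂ) ^ 2) *
      (((s * riemannFun (greenArg x y s) : ℝ) : ℂ) * Complex.sin (k * (x - y : ℝ) * s)))
    (fun k _ => (continuousOn_greenKernel k hy).slice_right hx) ?_ ?_ (mem_univ k)
  · rw [intervalIntegral.integral_const_mul, neg_mul] at h
    exact h
  · have h2 : ContinuousOn (fun p : ℂ × ℝ => (riemannFun (greenArg x y p.2) : ℂ))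
        (univ ×ˢ Icc 0 1) := hF.comp continuousOn_snd fun p hp => hp.2
    have h3 : ContinuousOn (fun p : ℂ × ℝ => -((x - y : ℝ) : ℂ) ^ 2 * ((p.2 *
        (riemannFun (greenArg x y p.2) : ℂ)) * Complex.sin (p.1 * (x - y : ℝ) * p.2)))
        (univ ×ˢ Icc 0 1) :=
      continuousOn_const.mul (((by fun_prop : ContinuousOn _ _).mul h2).mul (by fun_prop))
    refine h3.congr fun p _ => ?_
    simp only [Function.uncurry]
    push_cast; ring
  · intro k _ s _
    have h1 : HasDerivAt (fun k : ℂ => k * (x - y : ℝ) * s) (((x - y : ℝ) : ℂ) * s) k := by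
      simpa using ((hasDerivAt_id k).mul_const (((x - y : ℝ) : ℂ))).mul_const (s : ℂ)
    refine ((h1.ccos.const_mul ((x - y : ℝ) : ℂ)).mul_const
      (riemannFun (greenArg x y s) : ℂ)).congr_deriv ?_
    push_cast; ring

section Amplitude

variable {x y : ℝ}

lemma hasDerivAt_amplitude (hx : 0 < x) (hy : 0 < y) :
    ∀ s ∈ Icc (0 : ℝ) 1, HasDerivAt (fun s => s * riemannFun (greenArg x y s))
      (riemannFun (greenArg x y s) + s * (riemannFunDeriv (greenArg x y s) *
        ((x - y) ^ 2 * (-(2 * s)) / (4 * x * y)))) s := by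
  intro s hs
  refine ((hasDerivAt_id s).mul ((hasDerivAt_riemannFun (neg_one_lt_greenArg hx hy hs)).comp s
    (hasDerivAt_greenArg_right s))).congr_deriv ?_
  simp [Function.comp]

lemma continuousOn_amplitude_deriv (hx : 0 < x) (hy : 0 < y) :
    ContinuousOn (fun s => riemannFun (greenArg x y s) + s * (riemannFunDeriv (greenArg x y s) *
        ((x - y) ^ 2 * (-(2 * s)) / (4 * x * y)))) (Icc 0 1) := by
  have hg : ContinuousOn (greenArg x y) (Icc 0 1) :=
    fun s _ => (hasDerivAt_greenArg_right s).continuousAt.continuousWithinAt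
  have hm : MapsTo (greenArg x y) (Icc 0 1) (Ioi (-1)) :=
    fun s hs => neg_one_lt_greenArg hx hy hs
  exact (continuousOn_riemannFun.comp hg hm).add (continuousOn_id.mul
    ((continuousOn_riemannFunDeriv.comp hg hm).mul (by fun_prop)))

/-- The Riemann function is nonnegative and nonincreasing, and its argument decreases in $s$, so
both terms of the product rule are nonnegative. -/
lemma amplitude_deriv_nonneg (hx : 0 < x) (hy : 0 < y) :
    ∀ s ∈ Icc (0 : ℝ) 1, 0 ≤ riemannFun (greenArg x y s) + s *
      (riemannFunDeriv (greenArg x y s) * ((x - y) ^ 2 * (-(2 * s)) / (4 * x * y))) := by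
  intro s hs
  have hm := neg_one_lt_greenArg hx hy hs
  have h1 := riemannFun_nonneg hm
  have h2 := riemannFunDeriv_nonpos hm
  have h3 : (x - y) ^ 2 * (-(2 * s)) / (4 * x * y) ≤ 0 := by
    apply div_nonpos_of_nonpos_of_nonneg _ (by positivity)
    exact mul_nonpos_of_nonneg_of_nonpos (sq_nonneg _) (by linarith [hs.1])
  exact add_nonneg h1 (mul_nonneg hs.1 (mul_nonneg_of_nonpos_of_nonpos h2 h3))

lemma amplitude_nonneg (hx : 0 < x) (hy : 0 < y) :
    ∀ s ∈ Icc (0 : ℝ) 1, 0 ≤ s * riemannFun (greenArg x y s) :=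
  fun _ hs => mul_nonneg hs.1 (riemannFun_nonneg (neg_one_lt_greenArg hx hy hs))

lemma amplitude_le (hy : 0 < y) (hyx : y ≤ x) :
    ∀ s ∈ Ico (0 : ℝ) 1, s * riemannFun (greenArg x y s) ≤
      6 * (1 + Real.log (x / y)) * Real.sqrt (y / x) / Real.sqrt (1 - s) := by
  intro s hs
  have h := riemannFun_nonneg (neg_one_lt_greenArg (hy.trans_le hyx) hy (Ico_subset_Icc_self hs))
  exact (mul_le_of_le_one_left h hs.2.le).trans (riemannFun_greenArg_le hy hyx hs)

/-- Bound for the amplitude integral by cancellation, uniformly in the amplitude. -/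
lemma norm_amplitude_integral_le_inv (hx : 0 < x) (hy : 0 < y) {κ : ℂ} (hκ : κ ≠ 0) :
    ‖∫ s in (0 : ℝ)..1, ((s * riemannFun (greenArg x y s) : ℝ) : ℂ) * Complex.sin (κ * s)‖ ≤
      2 / ‖κ‖ * Real.exp |κ.im| := by
  have h := norm_integral_mul_sin_le zero_le_one (hasDerivAt_amplitude hx hy)
    (continuousOn_amplitude_deriv hx hy) (amplitude_deriv_nonneg hx hy)
    (amplitude_nonneg hx hy 0 ⟨le_rfl, zero_le_one⟩) hκ
  have e : (1 : ℝ) * riemannFun (greenArg x y 1) = 1 := by simp [greenArg, riemannFun_zero]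
  rwa [e, mul_one, mul_one] at h

lemma norm_amplitude_integral_le_inv_sqrt (hy : 0 < y) (hyx : y ≤ x) {κ : ℂ} (hκ : κ ≠ 0) :
    ‖∫ s in (0 : ℝ)..1, ((s * riemannFun (greenArg x y s) : ℝ) : ℂ) * Complex.sin (κ * s)‖ ≤
      4 * (6 * (1 + Real.log (x / y)) * Real.sqrt (y / x)) / Real.sqrt ‖κ‖ *
        Real.exp |κ.im| := by
  have hx : 0 < x := hy.trans_le hyx
  have hlog : 0 ≤ Real.log (x / y) := Real.log_nonneg (by rwa [one_le_div hy])
  exact norm_integral_mul_sin_le_inv_sqrt (hasDerivAt_amplitude hx hy)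
    (continuousOn_amplitude_deriv hx hy) (amplitude_deriv_nonneg hx hy)
    (amplitude_nonneg hx hy) (by positivity) (amplitude_le hy hyx) hκ

/-- For low frequency no cancellation is needed: $|\sin(\kappa
s)|\le|\kappa|e^{|\mathrm{Im}\,\kappa|}$ against an integrable singularity. -/
lemma norm_amplitude_integral_le_mul (hy : 0 < y) (hyx : y ≤ x) (κ : ℂ) :
    ‖∫ s in (0 : ℝ)..1, ((s * riemannFun (greenArg x y s) : ℝ) : ℂ) * Complex.sin (κ * s)‖ ≤
      2 * (6 * (1 + Real.log (x / y)) * Real.sqrt (y / x)) * ‖κ‖ * Real.exp |κ.im| := by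
  have hx : 0 < x := hy.trans_le hyx
  have hlog : 0 ≤ Real.log (x / y) := Real.log_nonneg (by rwa [one_le_div hy])
  set Λ := 6 * (1 + Real.log (x / y)) * Real.sqrt (y / x)
  have hΛ : 0 ≤ Λ := by positivity
  have h := norm_integral_le_of_le_inv_sqrt (b := 0) (Λ := Λ * (‖κ‖ * Real.exp |κ.im|))
    (h := fun s => ((s * riemannFun (greenArg x y s) : ℝ) : ℂ) * Complex.sin (κ * s))
    zero_le_one fun s hs => ?_
  · refine h.trans (le_of_eq ?_)
    rw [sub_zero, Real.sqrt_one]; ring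
  · rw [norm_mul, Complex.norm_real,
      Real.norm_of_nonneg (amplitude_nonneg hx hy s (Ico_subset_Icc_self hs)), mul_div_right_comm]
    refine mul_le_mul (amplitude_le hy hyx s hs) ?_ (norm_nonneg _) (by positivity)
    refine (norm_sin_le_norm_mul_exp _).trans ?_
    have h1 : ‖κ * (s : ℂ)‖ ≤ ‖κ‖ := by
      rw [norm_mul, Complex.norm_real, Real.norm_of_nonneg hs.1]
      exact mul_le_of_le_one_right (norm_nonneg _) hs.2.le
    have h2 := abs_im_mul_ofReal_le κ hs.1 hs.2.le
    rw [mul_one] at h2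
    gcongr

end Amplitude

/-! ### The derivative bound for the Green's function. -/

lemma rpow_three_halves {t : ℝ} (ht : 0 ≤ t) : t ^ (3 / 2 : ℝ) = t * Real.sqrt t := by
  rcases ht.eq_or_lt with rfl | ht
  · rw [Real.zero_rpow (by norm_num)]; simp
  · rw [Real.sqrt_eq_rpow, ← Real.rpow_one_add' ht.le (by norm_num)]; norm_num

/-- Lower bound for `x / (1 + K x)` when `K x ≤ 1`. -/
lemma half_le_div_one_add {K x : ℝ} (hK : 0 ≤ K) (hx : 0 < x) (h : K * x ≤ 1) :
    x / 2 ≤ x / (1 + K * x) := by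
  have : 0 ≤ K * x := by positivity
  gcongr
  linarith

/-- Lower bound for `x / (1 + K x)` when `K x ≥ 1`. -/
lemma inv_le_div_one_add {K x : ℝ} (hK : 0 < K) (hx : 0 < x) (h : 1 ≤ K * x) :
    1 / (2 * K) ≤ x / (1 + K * x) := by
  rw [div_le_div_iff₀ (by positivity) (by positivity)]
  linarith

/-- The derivative bound for the integral representation of the free Green's function. -/
lemma norm_greenRep_param_deriv_le (k : ℂ) {x y : ℝ} (hy : 0 < y) (hyx : y ≤ x) :
    ‖-(((x - y : ℝ) : ℂ) ^ 2 * ∫ s in (0 : ℝ)..1,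
      ((s * riemannFun (greenArg x y s) : ℝ) : ℂ) * Complex.sin (k * (x - y : ℝ) * s))‖ ≤
    100 * (‖k‖ * x) * (x / (1 + ‖k‖ * x)) ^ (3 / 2 : ℝ) *
      (y / (1 + ‖k‖ * y)) ^ (1 / 2 : ℝ) *
      (1 + Real.log (x / y)) * Real.exp (|k.im| * (x - y)) := by
  have hx : 0 < x := hy.trans_le hyx
  have hlog : 0 ≤ Real.log (x / y) := Real.log_nonneg (by rwa [one_le_div hy])
  set K := ‖k‖ with hK
  have hK0 : 0 ≤ K := norm_nonneg k
  set ℓ := 1 + Real.log (x / y) with hℓ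
  have hℓ1 : 1 ≤ ℓ := by linarith
  have hℓ0 : 0 < ℓ := by linarith
  have hP0 : 0 ≤ x / (1 + K * x) := by positivity
  rw [rpow_three_halves hP0, ← Real.sqrt_eq_rpow, norm_neg, norm_mul, norm_pow, Complex.norm_real]
  rcases hyx.eq_or_lt with rfl | hlt
  · rw [sub_self, norm_zero, zero_pow two_ne_zero, zero_mul]
    positivity
  set L := x - y with hL
  have hL0 : 0 < L := by linarith
  have hLx : L ≤ x := by linarith
  rw [Real.norm_of_nonneg hL0.le]
  have him : |(k * (L : ℂ)).im| = |k.im| * L := by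
    rw [Complex.im_mul_ofReal, abs_mul, abs_of_pos hL0]
  have hnorm : ‖k * (L : ℂ)‖ = K * L := by
    rw [norm_mul, Complex.norm_real, Real.norm_of_nonneg hL0.le]
  have hsx := Real.sqrt_pos.2 hx
  have hsy := Real.sqrt_pos.2 hy
  have hsqx := Real.mul_self_sqrt hx.le
  have hsyx : Real.sqrt (y / x) = Real.sqrt y / Real.sqrt x := Real.sqrt_div hy.le x
  set e := Real.exp (|k.im| * L) with he
  have he0 : 0 < e := Real.exp_pos _
  set T := ‖∫ s in (0 : ℝ)..1,
      ((s * riemannFun (greenArg x y s) : ℝ) : ℂ) * Complex.sin (k * (L : ℂ) * s)‖ with hT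
  have hsq2 : Real.sqrt 2 * Real.sqrt 2 = 2 := Real.mul_self_sqrt (by norm_num)
  have hs2 : 0 < Real.sqrt 2 := Real.sqrt_pos.2 (by norm_num)
  rcases le_or_gt (K * x) 1 with h1 | h1
  -- Regime $|k|x\le1$: both quotients are comparable to $x$ and $y$. The constant is $12\cdot4=48$.
  · have hb := norm_amplitude_integral_le_mul hy hyx (k * (L : ℂ))
    rw [him, hnorm, hsyx] at hb
    have hQ := half_le_div_one_add hK0 hx h1
    have hR := half_le_div_one_add hK0 hy
      ((mul_le_mul_of_nonneg_left hyx hK0).trans h1)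
    have hQs := Real.sqrt_le_sqrt hQ
    have hRs := Real.sqrt_le_sqrt hR
    rw [Real.sqrt_div hx.le] at hQs
    rw [Real.sqrt_div hy.le] at hRs
    calc L ^ 2 * T ≤ x ^ 2 * (2 * (6 * ℓ * (Real.sqrt y / Real.sqrt x)) * (K * x) * e) := by
          have : T ≤ 2 * (6 * ℓ * (Real.sqrt y / Real.sqrt x)) * (K * x) * e :=
            hb.trans (by gcongr)
          gcongr
      _ = 48 * (K * x) * (x / 2 * (Real.sqrt x / Real.sqrt 2)) *
            (Real.sqrt y / Real.sqrt 2) * ℓ * e := by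
          field_simp
          rw [sq (Real.sqrt x), sq (Real.sqrt 2), hsqx, hsq2]
          ring
      _ ≤ 100 * (K * x) * (x / (1 + K * x) * Real.sqrt (x / (1 + K * x))) *
            Real.sqrt (y / (1 + K * y)) * ℓ * e := by
          gcongr
          norm_num
  · have hKpos : 0 < K := by
      by_contra h
      have : K = 0 := le_antisymm (not_lt.1 h) hK0
      rw [this] at h1; simp at h1; linarith
    have hκ : k * (L : ℂ) ≠ 0 := by
      rw [← norm_pos_iff, hnorm]; positivity
    have hQ := inv_le_div_one_add hKpos hx h1.le
    have hQs := Real.sqrt_le_sqrt hQ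
    have hsK := Real.sqrt_pos.2 hKpos
    have hsqK := Real.mul_self_sqrt hKpos.le
    rw [Real.sqrt_div zero_le_one, Real.sqrt_one, Real.sqrt_mul (by norm_num)] at hQs
    rcases le_or_gt (K * y) 1 with h2 | h2
    -- Regime $|k|y\le1<|k|x$: the quotients are comparable to $1/|k|$ and $y$. The constant
    -- $24\cdot4=96$ is the largest of the three and dictates the $100$.
    · have hb := norm_amplitude_integral_le_inv_sqrt hy hyx hκ
      rw [him, hnorm, hsyx, Real.sqrt_mul hK0] at hb
      have hR := half_le_div_one_add hK0 hy h2
      have hRs := Real.sqrt_le_sqrt hR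
      rw [Real.sqrt_div hy.le] at hRs
      have hsL := Real.sqrt_pos.2 hL0
      have hsqL := Real.mul_self_sqrt hL0.le
      have hsLx := Real.sqrt_le_sqrt hLx
      calc L ^ 2 * T ≤ L ^ 2 * (4 * (6 * ℓ * (Real.sqrt y / Real.sqrt x)) /
              (Real.sqrt K * Real.sqrt L) * e) := by gcongr
        _ = L * Real.sqrt L * (4 * (6 * ℓ * (Real.sqrt y / Real.sqrt x)) / Real.sqrt K * e) := by
            rw [sq L]; nth_rw 2 [← hsqL]; field_simp
        _ ≤ x * Real.sqrt x * (4 * (6 * ℓ * (Real.sqrt y / Real.sqrt x)) / Real.sqrt K * e) := by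
            gcongr
        _ = 96 * (K * x) * (1 / (2 * K) * (1 / (Real.sqrt 2 * Real.sqrt K))) *
              (Real.sqrt y / Real.sqrt 2) * ℓ * e := by
            field_simp
            rw [sq (Real.sqrt 2), hsq2]
            ring
        _ ≤ 100 * (K * x) * (x / (1 + K * x) * Real.sqrt (x / (1 + K * x))) *
            Real.sqrt (y / (1 + K * y)) * ℓ * e := by
            gcongr
            norm_num
    -- Regime $|k|y>1$: both quotients are comparable to $1/|k|$, and the logarithmic factor is only
    -- used as $\ge1$.
    · have hb := norm_amplitude_integral_le_inv hx hy hκ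
      rw [him, hnorm] at hb
      have hRs := Real.sqrt_le_sqrt (inv_le_div_one_add hKpos hy h2.le)
      rw [Real.sqrt_div zero_le_one, Real.sqrt_one, Real.sqrt_mul (by norm_num)] at hRs
      calc L ^ 2 * T ≤ L ^ 2 * (2 / (K * L) * e) := by gcongr
        _ = L * (2 / K) * 1 * e := by field_simp
        _ ≤ x * (2 / K) * ℓ * e := by gcongr
        _ = 8 * (K * x) * (1 / (2 * K) * (1 / (Real.sqrt 2 * Real.sqrt K))) *
              (1 / (Real.sqrt 2 * Real.sqrt K)) * ℓ * e := by
            field_simp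
            rw [sq (Real.sqrt 2), hsq2, sq (Real.sqrt K), hsqK]
            ring
        _ ≤ 100 * (K * x) * (x / (1 + K * x) * Real.sqrt (x / (1 + K * x))) *
            Real.sqrt (y / (1 + K * y)) * ℓ * e := by
            gcongr
            norm_num

/-! ### Differentiability in $k$ and the regular solution as a limit of the Green's function. -/

lemma hasDerivAt_freeGreen (k : ℂ) {x y : ℝ} (hx : 0 < x) (hy : 0 < y) :
    HasDerivAt (fun κ : ℂ => freeGreen (κ ^ 2) x y) (-(((x - y : ℝ) : ℂ) ^ 2 * ∫ s in (0 : ℝ)..1,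
      ((s * riemannFun (greenArg x y s) : ℝ) : ℂ) * Complex.sin (k * (x - y : ℝ) * s))) k := by
  have : (fun κ : ℂ => freeGreen (κ ^ 2) x y) = fun κ => greenRep κ y x :=
    funext fun κ => freeGreen_eq_greenRep κ hx hy
  rw [this]
  exact hasDerivAt_greenRep_param k hx hy

lemma hasDerivAt_seriesArg_param (k : ℂ) (x : ℝ) :
    HasDerivAt (fun κ : ℂ => seriesArg (κ ^ 2) x) (-k * x ^ 2 / 2) k := by
  refine ((((hasDerivAt_id k).pow 2).neg.mul_const ((x : ℂ) ^ 2)).div_const 4).congr_deriv ?_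
  simp only [id]
  push_cast; ring

/-- The derivative of `besselA (seriesArg (k ^ 2) x)` with respect to `k`. -/
noncomputable def besselAParamDeriv (k : ℂ) (x : ℝ) : ℂ :=
  besselA' (seriesArg (k ^ 2) x) * (-k * x ^ 2 / 2)

/-- The derivative of `besselB (seriesArg (k ^ 2) x)` with respect to `k`. -/
noncomputable def besselBParamDeriv (k : ℂ) (x : ℝ) : ℂ :=
  besselB' (seriesArg (k ^ 2) x) * (-k * x ^ 2 / 2)

lemma hasDerivAt_besselA_param (k : ℂ) (x : ℝ) :
    HasDerivAt (fun κ : ℂ => besselA (seriesArg (κ ^ 2) x)) (besselAParamDeriv k x) k :=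
  (hasDerivAt_besselA _).comp k (hasDerivAt_seriesArg_param k x)

lemma hasDerivAt_besselB_param (k : ℂ) (x : ℝ) :
    HasDerivAt (fun κ : ℂ => besselB (seriesArg (κ ^ 2) x)) (besselBParamDeriv k x) k :=
  (hasDerivAt_besselB _).comp k (hasDerivAt_seriesArg_param k x)

lemma hasDerivAt_freePhi (k : ℂ) (x : ℝ) :
    HasDerivAt (fun κ : ℂ => freePhi (κ ^ 2) x)
      (Real.sqrt (Real.pi * x / 2) * besselAParamDeriv k x) k := by
  simp only [freePhi_eq]
  exact (hasDerivAt_besselA_param k x).const_mul _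

/-- Arranged to isolate the weight $1+\log\frac xy$: the added $1$ is compensated in the second
bracket, and both brackets extend continuously to $y=0$. -/
lemma deriv_freeGreen_eq (k : ℂ) {x y : ℝ} (hx : 0 < x) (hy : 0 < y) :
    deriv (fun κ : ℂ => freeGreen (κ ^ 2) x y) k = Real.sqrt x * Real.sqrt y *
      (((1 + Real.log (x / y) : ℝ) : ℂ) *
        (besselAParamDeriv k x * besselA (seriesArg (k ^ 2) y) +
          besselA (seriesArg (k ^ 2) x) * besselAParamDeriv k y) +
      (besselAParamDeriv k x * besselB (seriesArg (k ^ 2) y) +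
        besselA (seriesArg (k ^ 2) x) * besselBParamDeriv k y -
        besselAParamDeriv k y * (besselB (seriesArg (k ^ 2) x) + besselA (seriesArg (k ^ 2) x)) -
        besselA (seriesArg (k ^ 2) y) * (besselBParamDeriv k x + besselAParamDeriv k x))) := by
  have ax := hasDerivAt_besselA_param k x
  have ay := hasDerivAt_besselA_param k y
  have bx := hasDerivAt_besselB_param k x
  have bw := hasDerivAt_besselB_param k y
  have e : (fun κ : ℂ => freeGreen (κ ^ 2) x y) = fun κ => _ :=
    funext fun κ => freeGreen_eq (κ ^ 2) hx hy
  rw [e]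
  refine (((ax.mul ((ay.const_mul (-(Real.log y : ℂ))).add bw)).sub
    (ay.mul ((ax.const_mul (-(Real.log x : ℂ))).add bx))).const_mul
    ((Real.sqrt x : ℂ) * Real.sqrt y)).deriv.trans ?_
  simp only [Pi.add_apply]
  rw [Real.log_div hx.ne' hy.ne']
  push_cast
  ring

lemma continuous_seriesArg (z : ℂ) : Continuous (seriesArg z) := by
  unfold seriesArg; fun_prop

lemma continuous_besselA : Continuous besselA :=
  continuous_iff_continuousAt.2 fun ζ => (hasDerivAt_besselA ζ).continuousAt

lemma continuous_besselA' : Continuous besselA' :=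
  continuous_iff_continuousAt.2 fun ζ => (hasDerivAt_besselA' ζ).continuousAt

lemma continuous_besselB : Continuous besselB :=
  continuous_iff_continuousAt.2 fun ζ => (hasDerivAt_besselB ζ).continuousAt

lemma continuous_besselB' : Continuous besselB' :=
  continuous_iff_continuousAt.2 fun ζ => (hasDerivAt_besselB' ζ).continuousAt

lemma continuous_besselAParamDeriv (k : ℂ) : Continuous (besselAParamDeriv k) :=
  (continuous_besselA'.comp (continuous_seriesArg _)).mul (by fun_prop)

lemma continuous_besselBParamDeriv (k : ℂ) : Continuous (besselBParamDeriv k) :=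
  (continuous_besselB'.comp (continuous_seriesArg _)).mul (by fun_prop)

/-- As `y → 0`, the rescaled derivative of the Green's function tends to that of the regular
solution. -/
lemma tendsto_deriv_freeGreen (k : ℂ) {x : ℝ} (hx : 0 < x) :
    Tendsto (fun y : ℝ => ((1 / (Real.sqrt y * (1 + Real.log (x / y))) : ℝ) : ℂ) *
      deriv (fun κ : ℂ => freeGreen (κ ^ 2) x y) k) (𝓝[>] 0)
      (𝓝 (Real.sqrt x * besselAParamDeriv k x)) := by
  set u : ℝ → ℂ := fun y => besselAParamDeriv k x * besselA (seriesArg (k ^ 2) y) +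
    besselA (seriesArg (k ^ 2) x) * besselAParamDeriv k y with hu
  set v : ℝ → ℂ := fun y => besselAParamDeriv k x * besselB (seriesArg (k ^ 2) y) +
    besselA (seriesArg (k ^ 2) x) * besselBParamDeriv k y -
    besselAParamDeriv k y * (besselB (seriesArg (k ^ 2) x) + besselA (seriesArg (k ^ 2) x)) -
    besselA (seriesArg (k ^ 2) y) * (besselBParamDeriv k x + besselAParamDeriv k x) with hv
  have cA := continuous_besselA.comp (continuous_seriesArg (k ^ 2))
  have cB := continuous_besselB.comp (continuous_seriesArg (k ^ 2))
  have cA' := continuous_besselAParamDeriv k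
  have cB' := continuous_besselBParamDeriv k
  have cu : Continuous u := (continuous_const.mul cA).add (continuous_const.mul cA')
  have cv : Continuous v := (((continuous_const.mul cB).add (continuous_const.mul cB')).sub
    (cA'.mul continuous_const)).sub (cA.mul continuous_const)
  -- At $y=0$ the regular series is $1$ for every $k$, so its $k$-derivative vanishes there.
  have hu0 : u 0 = besselAParamDeriv k x := by
    simp [hu, seriesArg, besselA_zero, besselAParamDeriv]
  have hlog : Tendsto (fun y : ℝ => 1 + Real.log (x / y)) (𝓝[>] 0) atTop := by
    refine tendsto_atTop_add_const_left _ _ (Real.tendsto_log_atTop.comp ?_)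
    exact (tendsto_inv_nhdsGT_zero.const_mul_atTop hx).congr fun y => (div_eq_mul_inv _ _).symm
  have hinv : Tendsto (fun y : ℝ => (((1 + Real.log (x / y))⁻¹ : ℝ) : ℂ)) (𝓝[>] 0) (𝓝 0) := by
    have := (Complex.continuous_ofReal.tendsto 0).comp hlog.inv_tendsto_atTop
    rwa [Complex.ofReal_zero] at this
  have lim : Tendsto (fun y : ℝ => (Real.sqrt x : ℂ) *
      (u y + v y * (((1 + Real.log (x / y))⁻¹ : ℝ) : ℂ))) (𝓝[>] 0)
      (𝓝 (Real.sqrt x * (u 0 + v 0 * 0))) :=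
    tendsto_const_nhds.mul (((cu.tendsto 0).mono_left nhdsWithin_le_nhds).add
      (((cv.tendsto 0).mono_left nhdsWithin_le_nhds).mul hinv))
  rw [mul_zero, add_zero, hu0] at lim
  refine lim.congr' ?_
  filter_upwards [self_mem_nhdsWithin, hlog.eventually_gt_atTop 0] with y hy hl
  have hy' : 0 < y := hy
  rw [deriv_freeGreen_eq k hx hy']
  have h1 : (Real.sqrt y : ℂ) ≠ 0 := by exact_mod_cast (Real.sqrt_pos.2 hy').ne'
  generalize 1 + Real.log (x / y) = ℓ at *
  have h2 : (ℓ : ℂ) ≠ 0 := by exact_mod_cast hl.ne'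
  change _ = _ * (_ * ((ℓ : ℂ) * u y + v y))
  push_cast
  field_simp

/-- Let $y\to0$ in the bound for $G$: since $(y/(1+|k|y))^{1/2}\le\sqrt y$, the normalisation
cancels exactly the factors that depend on $y$, and $e^{|\mathrm{Im}\,k|(x-y)}\to
e^{|\mathrm{Im}\,k|x}$. -/
lemma norm_besselAParamDeriv_le (k : ℂ) {x : ℝ} (hx : 0 < x) :
    Real.sqrt x * ‖besselAParamDeriv k x‖ ≤
      100 * (‖k‖ * x) * (x / (1 + ‖k‖ * x)) ^ (3 / 2 : ℝ) * Real.exp (|k.im| * x) := by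
  have hl := (tendsto_deriv_freeGreen k hx).norm
  rw [norm_mul, Complex.norm_real, Real.norm_of_nonneg (Real.sqrt_nonneg x)] at hl
  have hc : Continuous fun y : ℝ => 100 * (‖k‖ * x) * (x / (1 + ‖k‖ * x)) ^ (3 / 2 : ℝ) *
      Real.exp (|k.im| * (x - y)) := by fun_prop
  have hr := (hc.tendsto 0).mono_left (nhdsWithin_le_nhds (s := Ioi 0))
  rw [sub_zero] at hr
  refine le_of_tendsto_of_tendsto hl hr ?_
  filter_upwards [Ioo_mem_nhdsGT hx] with y hy
  have hy0 : 0 < y := hy.1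
  have hlog : 0 ≤ Real.log (x / y) := Real.log_nonneg (by rw [one_le_div hy0]; exact hy.2.le)
  have hb := norm_greenRep_param_deriv_le k hy0 hy.2.le
  rw [← (hasDerivAt_freeGreen k hx hy0).deriv] at hb
  have hQ : (y / (1 + ‖k‖ * y)) ^ (1 / 2 : ℝ) ≤ Real.sqrt y := by
    rw [← Real.sqrt_eq_rpow]
    apply Real.sqrt_le_sqrt
    exact div_le_self hy0.le (by linarith [mul_nonneg (norm_nonneg k) hy0.le])
  have hsy := Real.sqrt_pos.2 hy0
  rw [norm_mul, Complex.norm_real, Real.norm_of_nonneg (by positivity), one_div,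
    inv_mul_le_iff₀ (by positivity)]
  refine hb.trans ?_
  calc _ ≤ 100 * (‖k‖ * x) * (x / (1 + ‖k‖ * x)) ^ (3 / 2 : ℝ) * Real.sqrt y *
        (1 + Real.log (x / y)) * Real.exp (|k.im| * (x - y)) := by gcongr
    _ = _ := by ring

theorem lemma2p3 :
    ∃ C : ℝ, 0 < C ∧
      (∀ (k : ℂ) (x : ℝ), 0 < x →
        DifferentiableAt ℂ (fun κ : ℂ => freePhi (κ ^ 2) x) k ∧
        ‖deriv (fun κ : ℂ => freePhi (κ ^ 2) x) k‖ ≤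
          C * (‖k‖ * x) * (x / (1 + ‖k‖ * x)) ^ (3 / 2 : ℝ) * Real.exp (|k.im| * x)) ∧
      (∀ (k : ℂ) (x y : ℝ), 0 < y → y ≤ x →
        DifferentiableAt ℂ (fun κ : ℂ => freeGreen (κ ^ 2) x y) k ∧
        ‖deriv (fun κ : ℂ => freeGreen (κ ^ 2) x y) k‖ ≤
          C * (‖k‖ * x) * (x / (1 + ‖k‖ * x)) ^ (3 / 2 : ℝ) *
            (y / (1 + ‖k‖ * y)) ^ (1 / 2 : ℝ) *
            (1 + Real.log (x / y)) * Real.exp (|k.im| * (x - y))) := by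
  -- The constant is $2\cdot100$, the factor $2$ coming from $\sqrt{\pi x/2}\le2\sqrt x$ in the
  -- bound for $\phi$.
  refine ⟨200, by norm_num, fun k x hx => ?_, fun k x y hy hyx => ?_⟩
  · have hd := hasDerivAt_freePhi k x
    refine ⟨hd.differentiableAt, ?_⟩
    rw [hd.deriv, norm_mul, Complex.norm_real, Real.norm_of_nonneg (Real.sqrt_nonneg _)]
    have hs : Real.sqrt (Real.pi * x / 2) ≤ 2 * Real.sqrt x := by
      apply Real.sqrt_le_iff.2 ⟨by positivity, ?_⟩
      rw [mul_pow, Real.sq_sqrt hx.le]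
      nlinarith [Real.pi_lt_four]
    calc Real.sqrt (Real.pi * x / 2) * ‖besselAParamDeriv k x‖
        ≤ 2 * Real.sqrt x * ‖besselAParamDeriv k x‖ := by gcongr
      _ = 2 * (Real.sqrt x * ‖besselAParamDeriv k x‖) := by ring
      _ ≤ 2 * (100 * (‖k‖ * x) * (x / (1 + ‖k‖ * x)) ^ (3 / 2 : ℝ) *
          Real.exp (|k.im| * x)) :=
          mul_le_mul_of_nonneg_left (norm_besselAParamDeriv_le k hx) zero_le_two
      _ = _ := by ring
  · have hx : 0 < x := hy.trans_le hyx
    have hd := hasDerivAt_freeGreen k hx hy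
    have hlog : 0 ≤ Real.log (x / y) := Real.log_nonneg (by rwa [one_le_div hy])
    refine ⟨hd.differentiableAt, ?_⟩
    rw [hd.deriv]
    refine (norm_greenRep_param_deriv_le k hy hyx).trans ?_
    gcongr
    norm_num
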